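/- **Setting.** Let $\beta=(0,0,1)$ and ${\bf F}(x)=\tfrac12(-x_2,x_1,0)$ on $\mathbb R^3$. Let $\dot H^1(\mathbb R^3)$ be the closure of $C_0^\infty(\mathbb R^3)$ under $\|\nabla f\|_{L^2}$ (a subspace of $L^6(\mathbb R^3)$), and $\dot H^1_{\rm div}=\{{\bf a}\in\dot H^1(\mathbb R^3;\mathbb R^3):\operatorname{div}{\bf a}=0\}$. For $\Omega\subset\mathbb R^3$ and $\kappa,H\in\mathbb R$ put $$\mathcal E_{\kappa,H}[\psi,{\bf A}]=\int_\Omega\Big\{|(-i\nabla+\kappa H{\bf A})\psi|^2-\kappa^2|\psi|^2+\tfrac{\kappa^2}{2}|\psi|^4\Big\}dx+\kappa^2H^2\int_{\mathbb R^3}|\operatorname{curl}{\bf A}-\beta|^2dx$$ for $\psi\in W^{1,2}(\Omega;\mathbb C)$ and ${\bf A}\in{\bf F}+\dot H^1_{\rm div}$, and let $\mathcal E^{\rm mod}_{\kappa,H}[\psi,{\bf A}]$, for $\psi\in W^{1,2}(\Omega;\mathbb C)$ and ${\bf A}\in W^{1,2}(\Omega;\mathbb R^3)$, be the same expression with the last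 integral over $\Omega$ instead of $\mathbb R^3$. Let $H^1_{\rm div}(\Omega)$ be the space of ${\bf A}\in W^{1,2}(\Omega;\mathbb R^3)$ with $\operatorname{div}{\bf A}=0$ in $\Omega$ and $N\cdot{\bf A}=0$ on $\partial\Omega$, where $N$ is the normal. **Theorem.** Let $\Omega\subset\mathbb R^3$ be a bounded domain with Lipschitz boundary. There exist constants $C,C'>0$ and, for every real $p\ge2$, a constant $C_p>0$, all independent of $\kappa,H,\psi,{\bf A}$, such that the following holds. Let $\kappa,H\in\mathbb R$ with $$\kappa(H-\kappa)\ge\tfrac12,$$ and let $(\psi,{\bf A})$ be * a minimizer of $\mathcal E_{\kappa,H}$ over $W^{1,2}(\Omega;\mathbb C)\times({\bf F}+\dot H^1_{\rm div})$, or * a minimizer of $\mathcal E^{\rm mod}_{\kappa,H}$ over $W^{1,2}(\Omega;\mathbb C)\times W^{1,2}(\Omega;\mathbb R^3)$, or * a minimizer of $\mathcal E^{\rm mod}_{\kappa,H}$ over $W^{1,2}(\Omega;\mathbb C)\times H^1_{\rm div}(\Omega)$, in the case that this gauge is available for the constant field, i.e. that some ${\bf F}_\Omega\in H^1_{\rm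 div}(\Omega)$ satisfies $\operatorname{curl}{\bf F}_\Omega=\beta$ in $\Omega$. Then $$\|\psi\|_{L^2(\Omega)}^2\le C\int_{\{x\in\Omega:\ \sqrt{\kappa(H-\kappa)}\,\operatorname{dist}(x,\partial\Omega)\le1\}}|\psi(x)|^2\,dx\le\frac{C'}{\sqrt{\kappa(H-\kappa)}},$$ and, for every real $p\ge2$, $\psi\in L^p(\Omega)$ and $$\|\psi\|_{L^2(\Omega)}\le C_p\,[\kappa(H-\kappa)]^{-\frac{p-2}{4p}}\,\|\psi\|_{L^p(\Omega)}.$$ -/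

import Mathlib

open MeasureTheory Filter Topology
open scoped ENNReal NNReal ContDiff

namespace GinzburgLandau

noncomputable section

/-- Three-dimensional Euclidean space. -/
abbrev E3 : Type := EuclideanSpace ℝ (Fin 3)

/-! ### Domains -/

/-- The boundary of `Ω` is Lipschitz: around every boundary point, in suitable orthonormal
coordinates `ξ = T x`, the set `Ω` is the region strictly above the graph of a Lipschitz
function `γ` of `(ξ₀, ξ₁)`. -/
def HasLipschitzBoundary (Ω : Set E3) : Prop :=
  ∀ p ∈ frontier Ω, ∃ (T : E3 ≃ₗᵢ[ℝ] E3) (r : ℝ) (K : ℝ≥0) (γ : EuclideanSpace ℝ (Fin 2) → ℝ),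
    0 < r ∧ LipschitzWith K γ ∧
      ∀ x ∈ Metric.ball p r, x ∈ Ω ↔ γ (!₂[T x 0, T x 1]) < T x 2

/-- A bounded domain (nonempty, open, connected) with Lipschitz boundary. -/
structure IsBoundedLipschitzDomain (Ω : Set E3) : Prop where
  isOpen : IsOpen Ω
  isConnected : IsConnected Ω
  isBounded : Bornology.IsBounded Ω
  lipschitz : HasLipschitzBoundary Ω

/-! ### Weak derivatives and Sobolev spaces

A function on `U` is represented by a function on the whole space; its values outside `U` never
matter. -/

/-- The test functions `C₀^∞(U)`. -/
def IsTestFunction (U : Set E3) (φ : E3 → ℝ) : Prop :=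
  ContDiff ℝ ∞ φ ∧ HasCompactSupport φ ∧ tsupport φ ⊆ U

/-- The classical partial derivative `∂ᵢ φ`. -/
def partialDeriv (i : Fin 3) (φ : E3 → ℝ) (x : E3) : ℝ :=
  fderiv ℝ φ x (EuclideanSpace.single i 1)

/-- `g` is the `i`-th weak partial derivative of `f` in `U`. -/
def IsWeakPartial {V : Type*} [NormedAddCommGroup V] [NormedSpace ℝ V]
    (U : Set E3) (i : Fin 3) (f g : E3 → V) : Prop :=
  LocallyIntegrableOn f U ∧ LocallyIntegrableOn g U ∧
    ∀ φ : E3 → ℝ, IsTestFunction U φ →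
      ∫ x in U, partialDeriv i φ x • f x = - ∫ x in U, φ x • g x

open Classical in
/-- The `i`-th weak partial derivative of `f` in the open set `U`, a function determined up to
equality almost everywhere in `U` (and `0` if there is no weak derivative). -/
def weakPartial {V : Type*} [NormedAddCommGroup V] [NormedSpace ℝ V]
    (U : Set E3) (i : Fin 3) (f : E3 → V) : E3 → V :=
  if h : ∃ g, IsWeakPartial U i f g then h.choose else 0

theorem weakPartial_ae_eq {V : Type*} [NormedAddCommGroup V] [NormedSpace ℝ V] [CompleteSpace V]
    {U : Set E3} (hU : IsOpen U) {i : Fin 3} {f g : E3 → V} (hg : IsWeakPartial U i f g) :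
    weakPartial U i f =ᵐ[volume.restrict U] g := by
  have hex : ∃ g, IsWeakPartial U i f g := ⟨g, hg⟩
  have hw : IsWeakPartial U i f (weakPartial U i f) := by
    rw [weakPartial, dif_pos hex]
    exact hex.choose_spec
  generalize weakPartial U i f = w at hw
  have int {h : E3 → V} (hh : LocallyIntegrableOn h U) {φ : E3 → ℝ} (hφ : IsTestFunction U φ) :
      IntegrableOn (fun x => φ x • h x) U :=
    (((hh.integrableOn_compact_subset hφ.2.2 hφ.2.1).continuousOn_smul
        hφ.1.continuous.continuousOn hφ.2.1).integrable_of_forall_notMem_eq_zero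
      fun x hx => by simp [image_eq_zero_of_notMem_tsupport hx]).integrableOn
  rw [Filter.EventuallyEq, ae_restrict_iff' hU.measurableSet]
  have := hU.ae_eq_zero_of_integral_contDiff_smul_eq_zero (μ := volume) (hw.2.1.sub hg.2.1)
    fun φ h1 h2 h3 => by
      have hφ : IsTestFunction U φ := ⟨h1, h2, h3⟩
      have e := neg_injective ((hw.2.2 φ hφ).symm.trans (hg.2.2 φ hφ))
      rw [← setIntegral_eq_integral_of_forall_compl_eq_zero (s := U)]
      · simp only [Pi.sub_apply, smul_sub]
        rw [integral_sub (int hw.2.1 hφ) (int hg.2.1 hφ), e, sub_self]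
      · intro x hx
        rw [image_eq_zero_of_notMem_tsupport fun hc => hx (h3 hc), zero_smul]
  filter_upwards [this] with x hx hxU using sub_eq_zero.1 (hx hxU)

/-- `f ∈ W^{1,2}(U)`. -/
def MemW12 {V : Type*} [NormedAddCommGroup V] [NormedSpace ℝ V]
    (U : Set E3) (f : E3 → V) : Prop :=
  MemLp f 2 (volume.restrict U) ∧
    ∀ i, ∃ g, IsWeakPartial U i f g ∧ MemLp g 2 (volume.restrict U)

/-- `f` belongs to the homogeneous Sobolev space of `ℝ³`, the closure of `C₀^∞(ℝ³)` under the norm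
`‖∇ f‖_{L²}`, realized as a space of functions in `L⁶(ℝ³)` (in which it embeds, by the Sobolev
inequality). -/
def MemHomH1 (f : E3 → ℝ) : Prop :=
  MemLp f 6 volume ∧
    ∃ φ : ℕ → E3 → ℝ, (∀ n, IsTestFunction Set.univ (φ n)) ∧
      Tendsto (fun n => eLpNorm (φ n - f) 6 volume) atTop (𝓝 0) ∧
      ∀ i, ∃ g : E3 → ℝ, MemLp g 2 volume ∧
        Tendsto (fun n => eLpNorm (partialDeriv i (φ n) - g) 2 volume) atTop (𝓝 0)

/-! ### Vector fields -/

/-- The weak divergence in `U`. -/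
def weakDiv (U : Set E3) (A : E3 → E3) (x : E3) : ℝ :=
  ∑ i, weakPartial U i (fun y => A y i) x

/-- The weak curl in `U`. -/
def weakCurl (U : Set E3) (A : E3 → E3) (x : E3) : E3 :=
  !₂[weakPartial U 1 (fun y => A y 2) x - weakPartial U 2 (fun y => A y 1) x,
     weakPartial U 2 (fun y => A y 0) x - weakPartial U 0 (fun y => A y 2) x,
     weakPartial U 0 (fun y => A y 1) x - weakPartial U 1 (fun y => A y 0) x]

/-- The constant exterior magnetic field `β = (0, 0, 1)`. -/
def beta : E3 := !₂[0, 0, 1]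

/-- The vector potential `F(x) = (-x₂, x₁, 0) / 2`. -/
def potentialF (x : E3) : E3 := !₂[-(x 1) / 2, x 0 / 2, 0]

/-- `A ∈ W^{1,2}(U; ℝ³)`. -/
def MemW12Vec (U : Set E3) (A : E3 → E3) : Prop :=
  ∀ j, MemW12 U (fun x => A x j)

/-- The divergence-free fields in the homogeneous Sobolev space of `ℝ³`. -/
def MemHomH1Div (a : E3 → E3) : Prop :=
  (∀ j, MemHomH1 (fun x => a x j)) ∧ weakDiv Set.univ a =ᵐ[volume] 0

/-- `N · A = 0` on `∂Ω`, in the weak form given by Green's formula. -/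
def HasZeroNormalTrace (Ω : Set E3) (A : E3 → E3) : Prop :=
  ∀ φ : E3 → ℝ, IsTestFunction Set.univ φ →
    ∫ x in Ω, ((∑ j, A x j * partialDeriv j φ x) + weakDiv Ω A x * φ x) = 0

/-- The fields `A ∈ W^{1,2}(Ω; ℝ³)` with `div A = 0` in `Ω` and `N · A = 0` on `∂Ω`. -/
def MemH1Div (Ω : Set E3) (A : E3 → E3) : Prop :=
  MemW12Vec Ω A ∧ weakDiv Ω A =ᵐ[volume.restrict Ω] 0 ∧ HasZeroNormalTrace Ω A

/-! ### The Ginzburg-Landau functionals -/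

/-- `p_{B A} ψ = (-i ∇ + B A) ψ` in `Ω`. -/
def magneticMomentum (Ω : Set E3) (B : ℝ) (A : E3 → E3) (ψ : E3 → ℂ) (x : E3) :
    EuclideanSpace ℂ (Fin 3) :=
  WithLp.toLp 2 fun j => -Complex.I * weakPartial Ω j ψ x + ((B * A x j : ℝ) : ℂ) * ψ x

/-- The Ginzburg-Landau energy whose magnetic term is integrated over `D`:
`∫_Ω (|p_{κ H A} ψ|² - κ² |ψ|² + (κ²/2) |ψ|⁴) + κ² H² ∫_D |curl A - β|²`.
The nonnegative terms are integrals with values in `[0, ∞]`; the negative one is finite for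
`ψ ∈ L²(Ω)`. So the value is the right one in `(-∞, ∞]` for all states considered. -/
def energyWith (D : Set E3) (κ H : ℝ) (Ω : Set E3) (ψ : E3 → ℂ) (A : E3 → E3) : EReal :=
  (((∫⁻ x in Ω, ‖magneticMomentum Ω (κ * H) A ψ x‖ₑ ^ 2)
      + ENNReal.ofReal (κ ^ 2 / 2) * (∫⁻ x in Ω, ‖ψ x‖ₑ ^ 4)
      + ENNReal.ofReal (κ ^ 2 * H ^ 2) * (∫⁻ x in D, ‖weakCurl D A x - beta‖ₑ ^ 2) : ℝ≥0∞) : EReal)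
    - ((κ ^ 2 * ∫ x in Ω, ‖ψ x‖ ^ 2 : ℝ) : EReal)

/-- The functional `𝓔_{κ,H}`, with the magnetic energy of the whole space. -/
def energy (κ H : ℝ) (Ω : Set E3) (ψ : E3 → ℂ) (A : E3 → E3) : EReal :=
  energyWith Set.univ κ H Ω ψ A

/-- The functional `𝓔^{mod}_{κ,H}`, with the magnetic energy of `Ω` only. -/
def energyMod (κ H : ℝ) (Ω : Set E3) (ψ : E3 → ℂ) (A : E3 → E3) : EReal :=
  energyWith Ω κ H Ω ψ A

/-- `(ψ, A)` minimizes `J` among the pairs with `ψ ∈ W^{1,2}(Ω; ℂ)` and `A` in the class `P`. -/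
def IsMinimizer (J : (E3 → ℂ) → (E3 → E3) → EReal) (Ω : Set E3) (P : (E3 → E3) → Prop)
    (ψ : E3 → ℂ) (A : E3 → E3) : Prop :=
  (MemW12 Ω ψ ∧ P A) ∧ ∀ (φ : E3 → ℂ) (B : E3 → E3), MemW12 Ω φ → P B → J ψ A ≤ J φ B

/-- Minimizers of `𝓔_{κ,H}`, the potential being `F` plus a divergence-free field of the
homogeneous Sobolev space. -/
def IsMinimizerE (κ H : ℝ) (Ω : Set E3) (ψ : E3 → ℂ) (A : E3 → E3) : Prop :=
  IsMinimizer (energy κ H Ω) Ω (fun A => MemHomH1Div (fun x => A x - potentialF x)) ψ A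

/-- Minimizers of `𝓔^{mod}_{κ,H}` over all potentials `A ∈ W^{1,2}(Ω; ℝ³)`. -/
def IsMinimizerMod (κ H : ℝ) (Ω : Set E3) (ψ : E3 → ℂ) (A : E3 → E3) : Prop :=
  IsMinimizer (energyMod κ H Ω) Ω (MemW12Vec Ω) ψ A

/-- Minimizers of `𝓔^{mod}_{κ,H}` in the fixed gauge `div A = 0`, `N · A = 0`. -/
def IsMinimizerModGauge (κ H : ℝ) (Ω : Set E3) (ψ : E3 → ℂ) (A : E3 → E3) : Prop :=
  IsMinimizer (energyMod κ H Ω) Ω (MemH1Div Ω) ψ A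

/-- The gauge `div A = 0`, `N · A = 0` is available for the constant field: there is a potential
`F_Ω` in this gauge, of class `W^{1,2}(Ω; ℝ³)`, with `curl F_Ω = β` in `Ω`. -/
def HasGaugedPotential (Ω : Set E3) : Prop :=
  ∃ G : E3 → E3, MemH1Div Ω G ∧ weakCurl Ω G =ᵐ[volume.restrict Ω] fun _ => beta

/-- The part of `Ω` where `√s · dist(x, ∂Ω) ≤ 1`. -/
def boundaryLayer (Ω : Set E3) (s : ℝ) : Set E3 :=
  {x ∈ Ω | √s * Metric.infDist x (frontier Ω) ≤ 1}

end

end GinzburgLandau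

namespace GinzburgLandau

noncomputable section

/-! ### Test functions -/

section TestFunctions

variable {U W : Set E3} {i : Fin 3} {φ η : E3 → ℝ}

/-! Write s = κ(H - κ) and let c be the third component of curl A - β. The hypothesis s ≥ 1/2 forces
κH = s + κ² > 0. In each of the three classes the state with ψ = 0 and a potential of curl β is
admissible and has zero energy. A minimizer therefore has energy at most 0, and this yields H² ∫_Ω
c² ≤ ∫_Ω |ψ|² (`IsMinimizingState.magnetic_energy_le`).

Two facts about ψ follow from the Euler-Lagrange equation in ψ alone (`euler_lagrange`). Testing it
with a multiple of ψ supported where |ψ| > 1 gives |ψ| ≤ 1 (`norm_le_one_of_minimizer`). Testing it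
with χ²ψ, χ a cutoff inside Ω, gives ∫|p(χψ)|² = ∫|∇χ|²|ψ|² + κ² ∫χ²|ψ|² - κ² ∫χ²|ψ|⁴, where p = -i∇
+ κHA.

On the other hand ∫|p u|² ≥ κH ∫ (1 + c)|u|² for u = χψ, because u is cut off inside Ω
(`magnetic_lower_bound`). The error is split as κH c χ²|ψ|² ≥ -κ² χ⁴|ψ|⁴ - H²c²/4. Its quartic part
is absorbed by the favourable -κ² ∫χ²|ψ|⁴, since χ⁴ ≤ χ², and its other part costs at most a quarter
of ∫|ψ|². Hence s ∫χ²|ψ|² ≤ ∫|∇χ|²|ψ|² + (1/4) ∫|ψ|² (`IsMinimizingState.cutoff_estimate`). No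
estimate of A itself is needed.

Taking χ = 1 outside the layer of width 1/√s, with |∇χ|² of order s, both sides scale like s, and s
≥ 1/2 lets the last term be absorbed: the mass of ψ is controlled by its mass in the layer. For a
Lipschitz boundary the layer has volume O(1/√s) (`exists_volume_layer_le`). Together with |ψ| ≤ 1
this gives the second inequality, and Hölder's inequality on the layer gives the L^p statement. -/

theorem IsTestFunction.mono (h : IsTestFunction U φ) (hUW : U ⊆ W) : IsTestFunction W φ :=
  ⟨h.1, h.2.1, h.2.2.trans hUW⟩

theorem IsTestFunction.mul_right (h : IsTestFunction U φ) (hη : ContDiff ℝ ∞ η) :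
    IsTestFunction U (fun x => φ x * η x) :=
  ⟨h.1.mul hη, h.2.1.mul_right, (tsupport_mul_subset_left (f := φ) (g := η)).trans h.2.2⟩

theorem IsTestFunction.mul_left (h : IsTestFunction U φ) (hη : ContDiff ℝ ∞ η) :
    IsTestFunction U (fun x => η x * φ x) := by
  simpa only [mul_comm] using h.mul_right hη

theorem contDiff_partialDeriv (h : ContDiff ℝ ∞ φ) : ContDiff ℝ ∞ (partialDeriv i φ) :=
  (h.fderiv_right (m := ∞) (by simp)).clm_apply contDiff_const

theorem IsTestFunction.partialDeriv (h : IsTestFunction U φ) (i : Fin 3) :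
    IsTestFunction U (partialDeriv i φ) := by
  have hs : tsupport (GinzburgLandau.partialDeriv i φ) ⊆ tsupport φ :=
    (tsupport_fderiv_apply_subset ℝ _)
  exact ⟨contDiff_partialDeriv h.1, h.2.1.of_isClosed_subset (isClosed_tsupport _) hs,
    hs.trans h.2.2⟩

theorem IsTestFunction.eq_zero (h : IsTestFunction U φ) {x : E3} (hx : x ∉ U) : φ x = 0 :=
  image_eq_zero_of_notMem_tsupport fun hc => hx (h.2.2 hc)

theorem partialDeriv_mul (hφ : ContDiff ℝ ∞ φ) (hη : ContDiff ℝ ∞ η) (x : E3) :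
    partialDeriv i (fun y => φ y * η y) x
      = φ x * partialDeriv i η x + η x * partialDeriv i φ x := by
  unfold partialDeriv
  rw [fderiv_fun_mul (hφ.differentiable (by simp) x) (hη.differentiable (by simp) x)]
  simp

end TestFunctions

/-! ### Weak derivatives -/

section WeakDerivatives

variable {V : Type*} [NormedAddCommGroup V] [NormedSpace ℝ V]
variable {U W : Set E3} {i : Fin 3} {f g f₁ g₁ : E3 → V} {φ η : E3 → ℝ}

theorem IsTestFunction.integrable_smul (hφ : IsTestFunction U φ) (hf : LocallyIntegrableOn f U) :
    Integrable (fun x => φ x • f x) :=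
  ((hf.integrableOn_compact_subset hφ.2.2 hφ.2.1).continuousOn_smul
        hφ.1.continuous.continuousOn hφ.2.1).integrable_of_forall_notMem_eq_zero
      fun x hx => by simp [image_eq_zero_of_notMem_tsupport hx]

theorem IsTestFunction.setIntegral_smul (hφ : IsTestFunction U φ) (f : E3 → V) :
    ∫ x in U, φ x • f x = ∫ x, φ x • f x :=
  setIntegral_eq_integral_of_forall_compl_eq_zero fun x hx => by simp [hφ.eq_zero hx]

theorem IsWeakPartial.mono (h : IsWeakPartial U i f g) (hWU : W ⊆ U) : IsWeakPartial W i f g := by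
  refine ⟨h.1.mono_set hWU, h.2.1.mono_set hWU, fun φ hφ => ?_⟩
  have hφ' := hφ.mono hWU
  rw [(hφ.partialDeriv i).setIntegral_smul, hφ.setIntegral_smul,
    ← (hφ'.partialDeriv i).setIntegral_smul, ← hφ'.setIntegral_smul]
  exact h.2.2 φ hφ'

theorem IsWeakPartial.integral_eq (h : IsWeakPartial U i f g) (hφ : IsTestFunction U φ) :
    ∫ x, partialDeriv i φ x • f x = - ∫ x, φ x • g x := by
  rw [← (hφ.partialDeriv i).setIntegral_smul, ← hφ.setIntegral_smul]
  exact h.2.2 φ hφ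

theorem isWeakPartial_of_integral_eq (hf : LocallyIntegrableOn f U) (hg : LocallyIntegrableOn g U)
    (h : ∀ φ, IsTestFunction U φ → ∫ x, partialDeriv i φ x • f x = - ∫ x, φ x • g x) :
    IsWeakPartial U i f g :=
  ⟨hf, hg, fun φ hφ => by
    rw [(hφ.partialDeriv i).setIntegral_smul, hφ.setIntegral_smul]
    exact h φ hφ⟩

theorem IsWeakPartial.add (h : IsWeakPartial U i f g) (h₁ : IsWeakPartial U i f₁ g₁) :
    IsWeakPartial U i (fun x => f x + f₁ x) (fun x => g x + g₁ x) := by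
  refine isWeakPartial_of_integral_eq (h.1.add h₁.1) (h.2.1.add h₁.2.1) fun φ hφ => ?_
  simp only [smul_add]
  rw [integral_add ((hφ.partialDeriv i).integrable_smul h.1)
      ((hφ.partialDeriv i).integrable_smul h₁.1),
    integral_add (hφ.integrable_smul h.2.1) (hφ.integrable_smul h₁.2.1), h.integral_eq hφ,
    h₁.integral_eq hφ, neg_add]

theorem IsWeakPartial.const_smul (h : IsWeakPartial U i f g) (c : ℝ) :
    IsWeakPartial U i (fun x => c • f x) (fun x => c • g x) := by
  refine isWeakPartial_of_integral_eq (h.1.smul c) (h.2.1.smul c) fun φ hφ => ?_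
  simp only [smul_comm _ c]
  rw [integral_smul, integral_smul, h.integral_eq hφ, smul_neg]

theorem isWeakPartial_zero : IsWeakPartial U i (fun _ => (0 : V)) (fun _ => 0) :=
  isWeakPartial_of_integral_eq locallyIntegrableOn_zero locallyIntegrableOn_zero (by simp)

/-- A continuously differentiable function has its classical derivatives as weak derivatives. -/
theorem isWeakPartial_of_contDiff (hf : ContDiff ℝ 1 f) :
    IsWeakPartial U i f (fun x => fderiv ℝ f x (EuclideanSpace.single i 1)) := by
  have hc : Continuous (fun x => fderiv ℝ f x (EuclideanSpace.single i 1)) :=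
    (hf.continuous_fderiv one_ne_zero).clm_apply continuous_const
  have h1 : LocallyIntegrableOn f U := hf.continuous.locallyIntegrable.locallyIntegrableOn U
  have h2 : LocallyIntegrableOn (fun x => fderiv ℝ f x (EuclideanSpace.single i 1)) U :=
    hc.locallyIntegrable.locallyIntegrableOn U
  refine isWeakPartial_of_integral_eq h1 h2 fun φ hφ => ?_
  rw [integral_smul_fderiv_eq_neg_fderiv_smul_of_integrable
    ((hφ.partialDeriv i).integrable_smul h1) (hφ.integrable_smul h2) (hφ.integrable_smul h1)
    (fun x _ => hφ.1.differentiable (by simp) x) fun x _ => hf.differentiable one_ne_zero x, neg_neg]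
  rfl

/-- The Leibniz rule, from testing with the product φη. Only the products are required to be test
functions of U, so compact support inside U may come from either factor: from φ in
`IsWeakPartial.smul_contDiff`, from η in `IsWeakPartial.smul_test`. -/
theorem IsWeakPartial.integral_mul_test (h : IsWeakPartial U i f g) (hφ : ContDiff ℝ ∞ φ)
    (hη : ContDiff ℝ ∞ η) (h₁ : IsTestFunction U (fun x => φ x * η x))
    (h₂ : IsTestFunction U (fun x => φ x * partialDeriv i η x)) :
    ∫ x, partialDeriv i φ x • η x • f x
      = - ∫ x, φ x • (η x • g x + partialDeriv i η x • f x) := by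
  have e := h.integral_eq h₁
  have i1 := (h₁.partialDeriv i).integrable_smul h.1
  have i2 := h₁.integrable_smul h.2.1
  have i3 := h₂.integrable_smul h.1
  have e1 : (fun x => partialDeriv i φ x • η x • f x) = fun x =>
      partialDeriv i (fun y => φ y * η y) x • f x - (φ x * partialDeriv i η x) • f x := by
    ext x
    rw [partialDeriv_mul hφ hη, ← sub_smul, smul_smul]
    congr 1
    ring
  have e2 : (fun x => φ x • (η x • g x + partialDeriv i η x • f x)) = fun x =>
      (φ x * η x) • g x + (φ x * partialDeriv i η x) • f x := by
    ext x
    rw [smul_add, smul_smul, smul_smul]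
  rw [e1, e2, integral_sub i1 i3, integral_add i2 i3, e]
  abel

theorem IsWeakPartial.smul_contDiff (hU : IsOpen U) (h : IsWeakPartial U i f g)
    (hη : ContDiff ℝ ∞ η) :
    IsWeakPartial U i (fun x => η x • f x) (fun x => η x • g x + partialDeriv i η x • f x) := by
  refine isWeakPartial_of_integral_eq (h.1.continuousOn_smul hU.isLocallyClosed hη.continuous.continuousOn)
    ((h.2.1.continuousOn_smul hU.isLocallyClosed hη.continuous.continuousOn).add
      (h.1.continuousOn_smul hU.isLocallyClosed (contDiff_partialDeriv hη).continuous.continuousOn))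
    fun φ hφ => ?_
  exact h.integral_mul_test hφ.1 hη (hφ.mul_right hη) (hφ.mul_right (contDiff_partialDeriv hη))

/-- Multiplication with a test function of `U` extends weak derivatives by zero. -/
theorem IsWeakPartial.smul_test (h : IsWeakPartial U i f g) (hη : IsTestFunction U η) :
    IsWeakPartial Set.univ i (fun x => η x • f x)
      (fun x => η x • g x + partialDeriv i η x • f x) := by
  refine isWeakPartial_of_integral_eq ((hη.integrable_smul h.1).locallyIntegrable.locallyIntegrableOn _)
    (((hη.integrable_smul h.2.1).add
      ((hη.partialDeriv i).integrable_smul h.1)).locallyIntegrable.locallyIntegrableOn _)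
    fun φ hφ => ?_
  exact h.integral_mul_test hφ.1 hη.1 (hη.mul_left hφ.1) ((hη.partialDeriv i).mul_left hφ.1)

theorem isWeakPartial_weakPartial (h : ∃ g, IsWeakPartial U i f g) :
    IsWeakPartial U i f (weakPartial U i f) := by
  rw [weakPartial, dif_pos h]
  exact h.choose_spec

theorem MemW12.isWeakPartial (h : MemW12 U f) (i : Fin 3) :
    IsWeakPartial U i f (weakPartial U i f) := by
  obtain ⟨g, hg, -⟩ := h.2 i
  exact isWeakPartial_weakPartial ⟨g, hg⟩

theorem MemW12.memLp_weakPartial [CompleteSpace V] (hU : IsOpen U) (h : MemW12 U f) (i : Fin 3) :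
    MemLp (weakPartial U i f) 2 (volume.restrict U) := by
  obtain ⟨g, hg, hg2⟩ := h.2 i
  exact (memLp_congr_ae (weakPartial_ae_eq hU hg)).2 hg2

end WeakDerivatives

/-! ### Square integrals -/

section SquareIntegrals

variable {α V : Type*} [MeasurableSpace α] {μ : Measure α} [NormedAddCommGroup V]

theorem eLpNorm_two_sq (f : α → V) (μ : Measure α) :
    eLpNorm f 2 μ ^ 2 = ∫⁻ x, ‖f x‖ₑ ^ 2 ∂μ := by
  have h := eLpNorm_nnreal_pow_eq_lintegral (f := f) (μ := μ) (p := 2) two_ne_zero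
  simpa using h

theorem tendsto_eLpNorm_two_iff {ι : Type*} {l : Filter ι} {f : ι → α → V} :
    Tendsto (fun n => eLpNorm (f n) 2 μ) l (𝓝 0) ↔
      Tendsto (fun n => ∫⁻ x, ‖f n x‖ₑ ^ 2 ∂μ) l (𝓝 0) := by
  simp only [← eLpNorm_two_sq]
  refine ⟨fun h => by simpa using ENNReal.Tendsto.pow (n := 2) h, fun h => ?_⟩
  have := (ENNReal.continuous_rpow_const (y := (1 / 2 : ℝ))).tendsto 0 |>.comp h
  rw [ENNReal.zero_rpow_of_pos (by norm_num)] at this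
  refine this.congr fun n => ?_
  rw [Function.comp_apply, ← ENNReal.rpow_natCast, ← ENNReal.rpow_mul]
  norm_num

theorem lintegral_enorm_sq_lt_top {f : α → V} (hf : MemLp f 2 μ) : ∫⁻ x, ‖f x‖ₑ ^ 2 ∂μ < ⊤ := by
  rw [← eLpNorm_two_sq]
  exact ENNReal.pow_lt_top hf.2

theorem memLp_two_of_lintegral_lt_top {f : α → V} (hf : AEStronglyMeasurable f μ)
    (h : ∫⁻ x, ‖f x‖ₑ ^ 2 ∂μ < ⊤) : MemLp f 2 μ := by
  refine ⟨hf, ?_⟩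
  rw [← eLpNorm_two_sq] at h
  by_contra hc
  rw [not_lt, top_le_iff] at hc
  simp [hc] at h

/-- Almost everywhere convergence without gain of norm is convergence in `L²`. -/
theorem tendsto_eLpNorm_two_of_ae {f : ℕ → α → V} {g : α → V}
    (hf : ∀ n, AEStronglyMeasurable (f n) μ) (hg : MemLp g 2 μ)
    (hfg : ∀ᵐ x ∂μ, Tendsto (fun n => f n x) atTop (𝓝 (g x)))
    (hle : ∀ n, eLpNorm (f n) 2 μ ≤ eLpNorm g 2 μ) :
    Tendsto (fun n => eLpNorm (f n - g) 2 μ) atTop (𝓝 0) := by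
  rw [tendsto_eLpNorm_two_iff]
  set S : ℝ≥0∞ := ∫⁻ x, ‖g x‖ₑ ^ 2 ∂μ with hS
  have hST : S < ⊤ := lintegral_enorm_sq_lt_top hg
  have hle' : ∀ n, ∫⁻ x, ‖f n x‖ₑ ^ 2 ∂μ ≤ S := fun n => by
    rw [hS, ← eLpNorm_two_sq, ← eLpNorm_two_sq]
    exact pow_le_pow_left' (hle n) 2
  have hpt : ∀ n x, ‖(f n - g) x‖ₑ ^ 2 ≤ 2 * ‖f n x‖ₑ ^ 2 + 2 * ‖g x‖ₑ ^ 2 := fun n x => by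
    have h1 : ‖(f n - g) x‖ ^ 2 ≤ 2 * ‖f n x‖ ^ 2 + 2 * ‖g x‖ ^ 2 := by
      have := norm_sub_le (f n x) (g x)
      have h0 := norm_nonneg ((f n - g) x)
      simp only [Pi.sub_apply] at *
      nlinarith [sq_nonneg (‖f n x‖ - ‖g x‖)]
    have := ENNReal.ofReal_le_ofReal h1
    rw [ENNReal.ofReal_add (by positivity) (by positivity), ENNReal.ofReal_mul (by norm_num),
      ENNReal.ofReal_mul (by norm_num), ENNReal.ofReal_pow (norm_nonneg _),
      ENNReal.ofReal_pow (norm_nonneg _), ENNReal.ofReal_pow (norm_nonneg _)] at this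
    simpa [ofReal_norm] using this
  -- Fatou's lemma is applied to these nonnegative functions. They converge to 4‖g‖², while their
  -- integrals plus ∫‖f n - g‖² never exceed 4S; so nothing is left for ∫‖f n - g‖² in the limit.
  set h : ℕ → α → ℝ≥0∞ := fun n x => (2 * ‖f n x‖ₑ ^ 2 + 2 * ‖g x‖ₑ ^ 2) - ‖(f n - g) x‖ₑ ^ 2
    with hh
  have hfm : ∀ n, AEMeasurable (fun x => ‖f n x‖ₑ ^ 2) μ := fun n => (hf n).enorm.pow_const 2
  have hgm : AEMeasurable (fun x => ‖g x‖ₑ ^ 2) μ := hg.1.enorm.pow_const 2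
  have hdm : ∀ n, AEMeasurable (fun x => ‖(f n - g) x‖ₑ ^ 2) μ := fun n =>
    ((hf n).sub hg.1).enorm.pow_const 2
  have hhm : ∀ n, AEMeasurable (h n) μ := fun n =>
    (((hfm n).const_mul 2).add (hgm.const_mul 2)).sub (hdm n)
  have hsum : ∀ n, ∫⁻ x, h n x ∂μ + ∫⁻ x, ‖(f n - g) x‖ₑ ^ 2 ∂μ ≤ 4 * S := fun n => by
    rw [← lintegral_add_right' _ (hdm n)]
    calc ∫⁻ x, (h n x + ‖(f n - g) x‖ₑ ^ 2) ∂μ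
        = ∫⁻ x, (2 * ‖f n x‖ₑ ^ 2 + 2 * ‖g x‖ₑ ^ 2) ∂μ :=
          lintegral_congr fun x => tsub_add_cancel_of_le (hpt n x)
      _ = 2 * ∫⁻ x, ‖f n x‖ₑ ^ 2 ∂μ + 2 * S := by
          rw [lintegral_add_right' _ (hgm.const_mul 2), lintegral_const_mul'' _ (hfm n),
            lintegral_const_mul'' _ hgm]
      _ ≤ 2 * S + 2 * S := by gcongr; exact hle' n
      _ = 4 * S := by ring
  have hlim : 4 * S ≤ liminf (fun n => ∫⁻ x, h n x ∂μ) atTop := by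
    refine le_trans (le_of_eq ?_) (lintegral_liminf_le' hhm)
    rw [hS, ← lintegral_const_mul'' _ hgm]
    refine lintegral_congr_ae ?_
    filter_upwards [hfg] with x hx
    have h1 : Tendsto (fun n => ‖f n x‖ₑ) atTop (𝓝 ‖g x‖ₑ) := hx.enorm
    have h2 : Tendsto (fun n => ‖(f n - g) x‖ₑ) atTop (𝓝 0) := by
      have := (hx.sub_const (g x)).enorm
      simpa using this
    have h3 : Tendsto (fun n => h n x) atTop
        (𝓝 ((2 * ‖g x‖ₑ ^ 2 + 2 * ‖g x‖ₑ ^ 2) - 0 ^ 2)) := by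
      refine ENNReal.Tendsto.sub ?_ (ENNReal.Tendsto.pow h2) (Or.inr (by simp))
      exact (ENNReal.Tendsto.const_mul (ENNReal.Tendsto.pow h1) (Or.inr (by simp))).add tendsto_const_nhds
    rw [h3.liminf_eq]
    ring_nf
    simp
  have hconv : Tendsto (fun n => ∫⁻ x, h n x ∂μ) atTop (𝓝 (4 * S)) :=
    tendsto_of_le_liminf_of_limsup_le hlim
      (limsup_le_of_le (h := Eventually.of_forall fun n => le_self_add.trans (hsum n)))
  have h4 : Tendsto (fun n => 4 * S - ∫⁻ x, h n x ∂μ) atTop (𝓝 (4 * S - 4 * S)) :=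
    ENNReal.Tendsto.sub tendsto_const_nhds hconv
      (Or.inl (ENNReal.mul_ne_top (by simp) hST.ne))
  rw [tsub_self] at h4
  refine tendsto_of_tendsto_of_tendsto_of_le_of_le tendsto_const_nhds h4 (fun _ => zero_le)
    fun n => ?_
  have h5 : ∫⁻ x, h n x ∂μ ≠ ⊤ := ne_top_of_le_ne_top (ENNReal.mul_ne_top (by simp) hST.ne)
    (le_self_add.trans (hsum n))
  exact ENNReal.le_sub_of_add_le_left h5 (hsum n)

end SquareIntegrals

/-! ### Mollification -/

section Mollification

variable {V : Type*} [NormedAddCommGroup V] [NormedSpace ℝ V]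
variable {ρ : ContDiffBump (0 : E3)} {u g : E3 → V} {i : Fin 3}

/-- The mollification of `u` with the normalized bump function `ρ`. -/
def mollify (ρ : ContDiffBump (0 : E3)) (u : E3 → V) : E3 → V :=
  convolution (ρ.normed volume) u (ContinuousLinearMap.lsmul ℝ ℝ) volume

theorem mollify_apply (ρ : ContDiffBump (0 : E3)) (u : E3 → V) (x : E3) :
    mollify ρ u x = ∫ t, ρ.normed volume t • u (x - t) := rfl

theorem mollify_eq_swap (ρ : ContDiffBump (0 : E3)) (u : E3 → V) (x : E3) :
    mollify ρ u x = ∫ t, ρ.normed volume (x - t) • u t :=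
  convolution_eq_swap _

theorem contDiff_mollify (hu : LocallyIntegrable u) : ContDiff ℝ ∞ (mollify ρ u) :=
  ρ.hasCompactSupport_normed.contDiff_convolution_left _ ρ.contDiff_normed hu

/-- The derivative falls on the kernel, and t ↦ ρ(x - t) is a test function for the weak derivative.
The sign from the reflection cancels the sign from the integration by parts. -/
theorem fderiv_mollify (hu : IsWeakPartial Set.univ i u g) (x : E3) :
    fderiv ℝ (mollify ρ u) x (EuclideanSpace.single i 1) = mollify ρ g x := by
  have hρ : ContDiff ℝ ∞ (ρ.normed volume) := ρ.contDiff_normed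
  have hu' : LocallyIntegrable u := locallyIntegrableOn_univ.1 hu.1
  have h1 := ρ.hasCompactSupport_normed.hasFDerivAt_convolution_right (μ := volume)
    (ContinuousLinearMap.lsmul ℝ ℝ).flip hu' (hρ.of_le (by simp)) x
  rw [convolution_flip] at h1
  rw [mollify_eq_swap, mollify, h1.fderiv, convolution_precompR_apply _ hu' (ρ.hasCompactSupport_normed.fderiv ℝ)
    (hρ.continuous_fderiv (by simp))]
  have hθ : IsTestFunction Set.univ (fun t => ρ.normed volume (x - t)) :=
    ⟨hρ.comp (contDiff_const.sub contDiff_id),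
      ρ.hasCompactSupport_normed.comp_homeomorph (Homeomorph.subLeft x), Set.subset_univ _⟩
  have h2 := hu.integral_eq hθ
  have h3 : ∀ t, partialDeriv i (fun t => ρ.normed volume (x - t)) t
      = - fderiv ℝ (ρ.normed volume) (x - t) (EuclideanSpace.single i 1) := fun t => by
    have := ((hρ.differentiable (by simp) (x - t)).hasFDerivAt).comp t
      ((hasFDerivAt_id t).const_sub x)
    unfold partialDeriv
    rw [HasFDerivAt.fderiv (f := fun t => ρ.normed volume (x - t)) this]
    simp
  simp only [h3, neg_smul, integral_neg, neg_inj] at h2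
  rw [← h2]
  rfl

theorem norm_mollify_le {M : ℝ} (hM : ∀ᵐ x, ‖u x‖ ≤ M) (x : E3) : ‖mollify ρ u x‖ ≤ M := by
  rw [mollify_apply]
  have h1 : ∀ᵐ t, ‖u (x - t)‖ ≤ M :=
    (Measure.measurePreserving_sub_left volume x).quasiMeasurePreserving.ae hM
  calc ‖∫ t, ρ.normed volume t • u (x - t)‖ ≤ ∫ t, ρ.normed volume t * M := by
        refine norm_integral_le_of_norm_le (ρ.integrable_normed.mul_const M) ?_
        filter_upwards [h1] with t ht
        rw [norm_smul, Real.norm_of_nonneg (ρ.nonneg_normed t)]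
        exact mul_le_mul_of_nonneg_left ht (ρ.nonneg_normed t)
    _ = M := by rw [integral_mul_const, ρ.integral_normed, one_mul]

theorem lintegral_ofReal_normed (ρ : ContDiffBump (0 : E3)) :
    ∫⁻ t, ENNReal.ofReal (ρ.normed volume t) = 1 := by
  rw [← ofReal_integral_eq_lintegral_ofReal ρ.integrable_normed
    (Eventually.of_forall ρ.nonneg_normed), ρ.integral_normed, ENNReal.ofReal_one]

/-- A mollification is an average of translates over the probability measure ρ dt. The pointwise
bound is L¹ ≤ L² for that measure; Tonelli's theorem and translation invariance finish. -/
theorem eLpNorm_mollify_le (hu : AEStronglyMeasurable u) :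
    eLpNorm (mollify ρ u) 2 volume ≤ eLpNorm u 2 volume := by
  wlog hs : StronglyMeasurable u generalizing u
  · have h := this hu.stronglyMeasurable_mk.aestronglyMeasurable hu.stronglyMeasurable_mk
    rw [eLpNorm_congr_ae hu.ae_eq_mk.symm] at h
    convert h using 2
    exact convolution_congr _ (ae_eq_refl _) hu.ae_eq_mk
  have hρm : Measurable fun t => ENNReal.ofReal (ρ.normed volume t) :=
    ρ.continuous_normed.measurable.ennreal_ofReal
  set ν : Measure E3 := volume.withDensity fun t => ENNReal.ofReal (ρ.normed volume t) with hν
  have : IsProbabilityMeasure ν := ⟨by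
    rw [hν, withDensity_apply _ MeasurableSet.univ, setLIntegral_univ, lintegral_ofReal_normed]⟩
  have key : ∀ x, ‖mollify ρ u x‖ₑ ^ 2 ≤ ∫⁻ t, ‖u (x - t)‖ₑ ^ 2 ∂ν := fun x => by
    have hm : StronglyMeasurable fun t => u (x - t) :=
      hs.comp_measurable (measurable_const.sub measurable_id)
    have h1 : ‖mollify ρ u x‖ₑ ≤ eLpNorm (fun t => u (x - t)) 1 ν := by
      rw [eLpNorm_one_eq_lintegral_enorm, hν, lintegral_withDensity_eq_lintegral_mul₀
        hρm.aemeasurable hm.enorm.aemeasurable, mollify_apply]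
      refine (enorm_integral_le_lintegral_enorm _).trans (le_of_eq (lintegral_congr fun t => ?_))
      rw [enorm_smul, Real.enorm_of_nonneg (ρ.nonneg_normed t)]
      rfl
    have h2 := eLpNorm_le_eLpNorm_of_exponent_le (μ := ν) (p := 1) (q := 2) (by norm_num)
      hm.aestronglyMeasurable
    rw [← eLpNorm_two_sq]
    exact pow_le_pow_left' (h1.trans h2) 2
  have hsq : eLpNorm (mollify ρ u) 2 volume ^ 2 ≤ eLpNorm u 2 volume ^ 2 := by
    rw [eLpNorm_two_sq, eLpNorm_two_sq]
    refine (lintegral_mono key).trans ?_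
    rw [lintegral_lintegral_swap]
    · simp only [lintegral_sub_right_eq_self (fun x => ‖u x‖ₑ ^ 2), lintegral_const, measure_univ,
        mul_one, le_refl]
    · exact ((hs.enorm.pow_const 2).comp measurable_sub).aemeasurable
  exact (ENNReal.pow_le_pow_left_iff two_ne_zero).1 hsq

/-- A compactly supported function with weak derivatives in `L²` is approximated by smooth
functions. -/
theorem exists_smooth_approx [CompleteSpace V] {Ω : Set E3} (hΩ : IsOpen Ω) {u : E3 → V}
    (hu : MemLp u 2 volume) (hc : HasCompactSupport u) (hs : tsupport u ⊆ Ω)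
    {g : Fin 3 → E3 → V} (hg : ∀ i, IsWeakPartial Set.univ i u (g i))
    (hg2 : ∀ i, MemLp (g i) 2 volume) :
    ∃ v : ℕ → E3 → V, (∀ n, ContDiff ℝ ∞ (v n)) ∧ (∀ n, HasCompactSupport (v n)) ∧
      (∀ n, tsupport (v n) ⊆ Ω) ∧ (∀ᵐ x, Tendsto (fun n => v n x) atTop (𝓝 (u x))) ∧
      Tendsto (fun n => eLpNorm (v n - u) 2 volume) atTop (𝓝 0) ∧
      (∀ i, Tendsto (fun n => eLpNorm
        ((fun x => fderiv ℝ (v n) x (EuclideanSpace.single i 1)) - g i) 2 volume) atTop (𝓝 0)) ∧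
      ∀ M : ℝ, (∀ᵐ x, ‖u x‖ ≤ M) → ∀ n x, ‖v n x‖ ≤ M := by
  obtain ⟨δ, hδ, hδΩ⟩ := IsCompact.exists_cthickening_subset_open hc hΩ hs
  have hr : ∀ n : ℕ, 0 < δ / (2 * (n + 1)) := fun n => by positivity
  -- Outer radius at most δ keeps the supports in the δ-thickening, hence in Ω. The fixed ratio 2 of
  -- the radii is what almost everywhere convergence at Lebesgue points asks for.
  let ρ : ℕ → ContDiffBump (0 : E3) := fun n =>
    ⟨δ / (2 * (n + 1)), δ / (n + 1), hr n, by
      rw [div_lt_div_iff_of_pos_left hδ (by positivity) (by positivity)]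
      have : (0 : ℝ) ≤ n := Nat.cast_nonneg n
      linarith⟩
  have hout : Tendsto (fun n => (ρ n).rOut) atTop (𝓝 0) := by
    have := (tendsto_one_div_add_atTop_nhds_zero_nat (𝕜 := ℝ)).const_mul δ
    simpa [ρ, div_eq_mul_inv] using this
  have hio : ∀ᶠ n in atTop, (ρ n).rOut ≤ 2 * (ρ n).rIn := Eventually.of_forall fun n => by
    simp only [ρ]
    rw [mul_comm 2 ((n : ℝ) + 1), ← div_div]
    linarith
  have hL : LocallyIntegrable u := hu.locallyIntegrable (by norm_num)
  have hsupp : ∀ n, tsupport (mollify (ρ n) u) ⊆ Metric.cthickening δ (tsupport u) := fun n => by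
    refine closure_minimal ?_ Metric.isClosed_cthickening
    refine (support_convolution_subset _).trans ?_
    rw [(ρ n).support_normed_eq]
    rintro _ ⟨y, hy, z, hz, rfl⟩
    refine Metric.mem_cthickening_of_dist_le _ z δ _ (subset_tsupport u hz) ?_
    rw [dist_eq_norm]
    simp only [add_sub_cancel_right]
    have h1 : ‖y‖ < (ρ n).rOut := by simpa using hy
    refine h1.le.trans ?_
    simp only [ρ]
    exact div_le_self hδ.le (by simp)
  have hconv : ∀ {w : E3 → V}, MemLp w 2 volume →
      (∀ᵐ x, Tendsto (fun n => mollify (ρ n) w x) atTop (𝓝 (w x))) ∧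
      Tendsto (fun n => eLpNorm (mollify (ρ n) w - w) 2 volume) atTop (𝓝 0) := by
    intro w hw
    have hwL : LocallyIntegrable w := hw.locallyIntegrable (by norm_num)
    have hae := ContDiffBump.ae_convolution_tendsto_right_of_locallyIntegrable (μ := volume)
      hout hio hwL
    exact ⟨hae, tendsto_eLpNorm_two_of_ae
      (fun n => (contDiff_mollify hwL).continuous.aestronglyMeasurable) hw hae
      fun n => eLpNorm_mollify_le hw.1⟩
  refine ⟨fun n => mollify (ρ n) u, fun n => contDiff_mollify hL, fun n => ?_,
    fun n => (hsupp n).trans hδΩ, (hconv hu).1, (hconv hu).2, fun i => ?_,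
    fun M hM n x => norm_mollify_le hM x⟩
  · exact (IsCompact.cthickening hc).of_isClosed_subset (isClosed_tsupport _) (hsupp n)
  · simpa only [fderiv_mollify (hg i)] using (hconv (hg2 i)).2

end Mollification

/-! ### Cutoff functions -/

theorem lipschitzWith_mollify {ρ : ContDiffBump (0 : E3)} {f : E3 → ℝ} {K : ℝ≥0}
    (hf : LipschitzWith K f) : LipschitzWith K (mollify ρ f) := by
  have hi : ∀ x, Integrable fun t => ρ.normed volume t • f (x - t) := fun x =>
    (ρ.continuous_normed.smul (hf.continuous.comp (continuous_const.sub continuous_id)))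
      |>.integrable_of_hasCompactSupport ρ.hasCompactSupport_normed.smul_right
  refine LipschitzWith.of_dist_le_mul fun x y => ?_
  rw [dist_eq_norm, mollify_apply, mollify_apply, ← integral_sub (hi x) (hi y)]
  calc ‖∫ t, (ρ.normed volume t • f (x - t) - ρ.normed volume t • f (y - t))‖
      ≤ ∫ t, ρ.normed volume t * (K * dist x y) := by
        refine norm_integral_le_of_norm_le (ρ.integrable_normed.mul_const _)
          (Eventually.of_forall fun t => ?_)
        rw [← smul_sub, norm_smul, Real.norm_of_nonneg (ρ.nonneg_normed t)]
        refine mul_le_mul_of_nonneg_left ?_ (ρ.nonneg_normed t)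
        have := hf.dist_le_mul (x - t) (y - t)
        rwa [dist_eq_norm, dist_sub_right] at this
    _ = K * dist x y := by rw [integral_mul_const, ρ.integral_normed, one_mul]

theorem abs_partialDeriv_le {f : E3 → ℝ} {K : ℝ≥0} (hf : LipschitzWith K f) (i : Fin 3) (x : E3) :
    |partialDeriv i f x| ≤ K := by
  have h := (fderiv ℝ f x).le_opNorm (EuclideanSpace.single i 1)
  rw [PiLp.norm_single, norm_one, mul_one] at h
  exact h.trans (norm_fderiv_le_of_lipschitz ℝ hf)

/-- A cutoff function of a bounded open set which is `1` at distance `δ` from the complement, with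
gradient of order `1 / δ`. -/
theorem exists_cutoff {Ω : Set E3} (hb : Bornology.IsBounded Ω) {δ : ℝ} (hδ : 0 < δ) :
    ∃ χ : E3 → ℝ, IsTestFunction Ω χ ∧ (∀ x, 0 ≤ χ x) ∧ (∀ x, χ x ≤ 1) ∧
      (∀ i x, |partialDeriv i χ x| ≤ 4 / δ) ∧ (∀ x, δ ≤ Metric.infDist x Ωᶜ → χ x = 1) ∧
      ∀ i x, δ < Metric.infDist x Ωᶜ → partialDeriv i χ x = 0 := by
  set d : E3 → ℝ := fun x => Metric.infDist x Ωᶜ with hd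
  have hdl : LipschitzWith 1 d := Metric.lipschitz_infDist_pt _
  have hdx : ∀ x y, |d x - d y| ≤ dist x y := fun x y => by
    simpa [Real.dist_eq] using hdl.dist_le_mul x y
  -- A ramp in the distance d to the complement: 0 for d ≤ δ/2, 1 for d ≥ 3δ/4, slope 4/δ. Smoothing
  -- at scale δ/4 widens the transition to δ/4 ≤ d ≤ δ and preserves the Lipschitz constant.
  set f : E3 → ℝ := fun x => max 0 (min 1 (4 / δ * d x - 2)) with hf
  have hK : (0 : ℝ) ≤ 4 / δ := by positivity
  have hfl : LipschitzWith ⟨4 / δ, hK⟩ f := by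
    refine LipschitzWith.const_max (LipschitzWith.const_min ?_ 1) 0
    refine LipschitzWith.of_dist_le_mul fun x y => ?_
    rw [Real.dist_eq, show 4 / δ * d x - 2 - (4 / δ * d y - 2) = 4 / δ * (d x - d y) by ring,
      abs_mul, abs_of_nonneg hK]
    exact mul_le_mul_of_nonneg_left (hdx x y) hK
  have hf0 : ∀ x, d x ≤ δ / 2 → f x = 0 := fun x hx => by
    have : 4 / δ * d x ≤ 2 := by
      calc 4 / δ * d x ≤ 4 / δ * (δ / 2) := by gcongr
        _ = 2 := by field_simp; norm_num
    exact max_eq_left ((min_le_right _ _).trans (by linarith))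
  have hf1 : ∀ x, 3 * δ / 4 ≤ d x → f x = 1 := fun x hx => by
    have : 3 ≤ 4 / δ * d x := by
      calc 3 = 4 / δ * (3 * δ / 4) := by field_simp
        _ ≤ 4 / δ * d x := by gcongr
    rw [hf]
    simp only
    rw [min_eq_left (by linarith)]
    norm_num
  let ρ : ContDiffBump (0 : E3) := ⟨δ / 8, δ / 4, by positivity, by linarith⟩
  have hχ1 : ∀ x, δ ≤ d x → mollify ρ f x = 1 := fun x hx => by
    rw [← hf1 x (by linarith)]
    refine ρ.normed_convolution_eq_right fun y hy => ?_
    rw [hf1 x (by linarith), hf1 y]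
    have := (abs_le.1 (hdx y x)).1
    have h2 : dist y x < δ / 4 := hy
    linarith
  have hχ0 : ∀ x, d x < δ / 4 → mollify ρ f x = 0 := fun x hx => by
    rw [← hf0 x (by linarith)]
    refine ρ.normed_convolution_eq_right fun y hy => ?_
    rw [hf0 x (by linarith), hf0 y]
    have := (abs_le.1 (hdx y x)).2
    have h2 : dist y x < δ / 4 := hy
    linarith
  have hsub : tsupport (mollify ρ f) ⊆ {x | δ / 4 ≤ d x} := by
    refine closure_minimal (fun x hx => ?_) (isClosed_le continuous_const hdl.continuous)
    by_contra hc
    exact hx (hχ0 x (not_le.1 hc))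
  have hsubΩ : {x | δ / 4 ≤ d x} ⊆ Ω := fun x hx => by
    by_contra hc
    have h1 : d x = 0 := Metric.infDist_zero_of_mem hc
    have h2 : δ / 4 ≤ d x := hx
    linarith
  have hflb : ∀ x, ‖f x‖ ≤ 1 := fun x => by
    rw [Real.norm_of_nonneg (le_max_left _ _)]
    exact max_le zero_le_one (min_le_left _ _)
  refine ⟨mollify ρ f, ⟨contDiff_mollify hfl.continuous.locallyIntegrable, ?_,
    hsub.trans hsubΩ⟩, fun x => ?_, fun x => ?_, fun i x => ?_, hχ1, fun i x hx => ?_⟩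
  · exact Metric.isCompact_of_isClosed_isBounded (isClosed_tsupport _)
      (hb.subset (hsub.trans hsubΩ))
  · rw [mollify_apply]
    exact integral_nonneg fun t => mul_nonneg (ρ.nonneg_normed t) (le_max_left _ _)
  · exact (Real.le_norm_self _).trans (norm_mollify_le (Eventually.of_forall hflb) x)
  · exact abs_partialDeriv_le (lipschitzWith_mollify hfl) i x
  · have h1 : mollify ρ f =ᶠ[𝓝 x] fun _ => 1 := by
      filter_upwards [(isOpen_lt continuous_const hdl.continuous).mem_nhds hx] with y hy
      exact hχ1 y (le_of_lt hy)
    unfold partialDeriv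
    rw [h1.fderiv_eq]
    simp

/-- A compact subset of a bounded open set keeps a positive distance to the complement. -/
theorem exists_pos_lt_infDist_compl {Ω K : Set E3} (hΩ : IsOpen Ω) (hb : Bornology.IsBounded Ω)
    (hK : IsCompact K) (hKΩ : K ⊆ Ω) : ∃ δ : ℝ, 0 < δ ∧ ∀ x ∈ K, δ < Metric.infDist x Ωᶜ := by
  have hne : Ωᶜ.Nonempty := Set.nonempty_compl.2 fun h =>
    NormedSpace.unbounded_univ ℝ E3 (h ▸ hb)
  rcases K.eq_empty_or_nonempty with rfl | hKne
  · exact ⟨1, one_pos, by simp⟩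
  obtain ⟨x₀, hx₀, hmin⟩ := hK.exists_isMinOn hKne
    (Metric.continuous_infDist_pt Ωᶜ).continuousOn
  have hpos : 0 < Metric.infDist x₀ Ωᶜ :=
    (hΩ.isClosed_compl.notMem_iff_infDist_pos hne).1 fun h => h (hKΩ hx₀)
  exact ⟨Metric.infDist x₀ Ωᶜ / 2, half_pos hpos, fun x hx =>
    (half_lt_self hpos).trans_le (hmin hx)⟩

/-! ### Convergence in `L²` -/

section Convergence

variable {α V : Type*} [MeasurableSpace α] {μ : Measure α} [NormedAddCommGroup V]

theorem tendsto_eLpNorm_two_of_dominated {f : ℕ → α → V} {h : α → ℝ}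
    (hf : ∀ n, AEStronglyMeasurable (f n) μ) (hh : MemLp h 2 μ)
    (hle : ∀ n, ∀ᵐ x ∂μ, ‖f n x‖ ≤ h x)
    (hlim : ∀ᵐ x ∂μ, Tendsto (fun n => f n x) atTop (𝓝 0)) :
    Tendsto (fun n => eLpNorm (f n) 2 μ) atTop (𝓝 0) := by
  rw [tendsto_eLpNorm_two_iff]
  have h0 : ∫⁻ _, (0 : ℝ≥0∞) ∂μ = 0 := by simp
  rw [← h0]
  refine tendsto_lintegral_of_dominated_convergence' (fun x => ‖h x‖ₑ ^ 2)
    (fun n => (hf n).enorm.pow_const 2) (fun n => ?_) (lintegral_enorm_sq_lt_top hh).ne ?_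
  · filter_upwards [hle n] with x hx
    refine pow_le_pow_left' ?_ 2
    rw [← ofReal_norm, ← ofReal_norm]
    exact ENNReal.ofReal_le_ofReal (hx.trans (Real.le_norm_self _))
  · filter_upwards [hlim] with x hx
    simpa using ENNReal.Tendsto.pow (n := 2) hx.enorm

theorem tendsto_integral_smul_of_eLpNorm_two [NormedSpace ℝ V] {f : ℕ → α → V}
    {g : α → V} {φ : α → ℝ} (hφ : MemLp φ 2 μ) (hf : ∀ n, MemLp (f n) 2 μ) (hg : MemLp g 2 μ)
    (h : Tendsto (fun n => eLpNorm (f n - g) 2 μ) atTop (𝓝 0)) :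
    Tendsto (fun n => ∫ x, φ x • f n x ∂μ) atTop (𝓝 (∫ x, φ x • g x ∂μ)) := by
  have hi : ∀ {w : α → V}, MemLp w 2 μ → Integrable (fun x => φ x • w x) μ := fun hw =>
    memLp_one_iff_integrable.1 (hw.smul hφ)
  refine tendsto_integral_of_L1' _ (hi hg).1 (Eventually.of_forall fun n => hi (hf n)) ?_
  have hb : ∀ n, eLpNorm ((fun x => φ x • f n x) - fun x => φ x • g x) 1 μ
      ≤ eLpNorm φ 2 μ * eLpNorm (f n - g) 2 μ := fun n => by
    have := eLpNorm_smul_le_mul_eLpNorm (r := 1) (p := 2) (q := 2) ((hf n).sub hg).1 hφ.1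
    convert this using 2
    ext x
    simp [smul_sub]
  refine tendsto_of_tendsto_of_tendsto_of_le_of_le tendsto_const_nhds ?_ (fun _ => zero_le) hb
  simpa using ENNReal.Tendsto.const_mul h (Or.inr hφ.2.ne)

theorem tendsto_integral_norm_sq {f : ℕ → α → V} {g : α → V} (hf : ∀ n, MemLp (f n) 2 μ)
    (hg : MemLp g 2 μ) (h : Tendsto (fun n => eLpNorm (f n - g) 2 μ) atTop (𝓝 0)) :
    Tendsto (fun n => ∫ x, ‖f n x‖ ^ 2 ∂μ) atTop (𝓝 (∫ x, ‖g x‖ ^ 2 ∂μ)) := by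
  have e : ∀ {w : α → V}, MemLp w 2 μ → ∫ x, ‖w x‖ ^ 2 ∂μ = ((eLpNorm w 2 μ) ^ 2).toReal := by
    intro w hw
    rw [eLpNorm_two_sq, integral_eq_lintegral_of_nonneg_ae
      (f := fun x => ‖w x‖ ^ 2) (Eventually.of_forall fun x => by positivity) (hw.1.norm.pow 2)]
    congr 1
    refine lintegral_congr fun x => ?_
    rw [ENNReal.ofReal_pow (norm_nonneg _), ofReal_norm]
  simp only [e (hf _), e hg]
  refine (ENNReal.tendsto_toReal (ENNReal.pow_ne_top hg.2.ne)).comp (ENNReal.Tendsto.pow ?_)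
  have h1 : ∀ n, eLpNorm (f n) 2 μ ≤ eLpNorm g 2 μ + eLpNorm (f n - g) 2 μ := fun n => by
    have := eLpNorm_add_le hg.1 ((hf n).sub hg).1 (p := 2) (by norm_num)
    simpa using this
  have h2 : ∀ n, eLpNorm g 2 μ - eLpNorm (f n - g) 2 μ ≤ eLpNorm (f n) 2 μ := fun n => by
    rw [tsub_le_iff_right]
    have := eLpNorm_sub_le (hf n).1 ((hf n).sub hg).1 (p := 2) (by norm_num)
    simpa using this
  refine tendsto_of_tendsto_of_tendsto_of_le_of_le ?_ ?_ h2 h1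
  · simpa using ENNReal.Tendsto.sub (tendsto_const_nhds (x := eLpNorm g 2 μ)) h
      (Or.inl hg.2.ne)
  · simpa using (tendsto_const_nhds (x := eLpNorm g 2 μ)).add h

end Convergence

theorem MemLp.locallyIntegrableOn_of_restrict {V : Type*} [NormedAddCommGroup V] {U : Set E3}
    {f : E3 → V} (hf : MemLp f 2 (volume.restrict U)) : LocallyIntegrableOn f U :=
  locallyIntegrableOn_of_locallyIntegrable_restrict (hf.locallyIntegrable (by norm_num))

theorem IsTestFunction.memLp {U : Set E3} {φ : E3 → ℝ} (hφ : IsTestFunction U φ) :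
    MemLp φ 2 volume :=
  hφ.1.continuous.memLp_of_hasCompactSupport hφ.2.1

/-! ### Cutting off and composing Sobolev functions -/

section Sobolev

variable {V W : Type*} [NormedAddCommGroup V] [NormedSpace ℝ V] [NormedAddCommGroup W]
  [NormedSpace ℝ W]
variable {Ω : Set E3} {f : E3 → V} {χ : E3 → ℝ}

theorem IsTestFunction.memLp_smul (hχ : IsTestFunction Ω χ) (hΩ : MeasurableSet Ω)
    (hf : MemLp f 2 (volume.restrict Ω)) : MemLp (fun x => χ x • f x) 2 volume := by
  obtain ⟨M, hM⟩ := hχ.2.1.exists_bound_of_continuous hχ.1.continuous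
  have h1 : MemLp (fun x => χ x • f x) 2 (volume.restrict Ω) :=
    (hf.const_smul M).mono (hχ.1.continuous.aestronglyMeasurable.smul hf.1)
      (Eventually.of_forall fun x => by
        rw [norm_smul, Pi.smul_apply, norm_smul]
        exact mul_le_mul_of_nonneg_right ((hM x).trans (Real.le_norm_self M)) (norm_nonneg _))
  rw [← memLp_indicator_iff_restrict hΩ] at h1
  have e : Ω.indicator (fun x => χ x • f x) = fun x => χ x • f x :=
    Set.indicator_eq_self.2 fun x hx => by
      by_contra hc
      exact hx (by simp [hχ.eq_zero hc])
  rw [e] at h1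
  exact h1

/-- Approximation of a Sobolev function, cut off inside `Ω`, by smooth functions. -/
theorem MemW12.exists_smooth_approx [CompleteSpace V] (hΩ : IsOpen Ω) (hf : MemW12 Ω f)
    (hχ : IsTestFunction Ω χ) :
    ∃ v : ℕ → E3 → V, (∀ n, ContDiff ℝ ∞ (v n)) ∧ (∀ n, HasCompactSupport (v n)) ∧
      (∀ n, tsupport (v n) ⊆ Ω) ∧ (∀ᵐ x, Tendsto (fun n => v n x) atTop (𝓝 (χ x • f x))) ∧
      Tendsto (fun n => eLpNorm (v n - fun x => χ x • f x) 2 volume) atTop (𝓝 0) ∧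
      (∀ i, Tendsto (fun n => eLpNorm ((fun x => fderiv ℝ (v n) x (EuclideanSpace.single i 1))
        - fun x => χ x • weakPartial Ω i f x + partialDeriv i χ x • f x) 2 volume) atTop (𝓝 0)) ∧
      ∀ M : ℝ, (∀ᵐ x, ‖χ x • f x‖ ≤ M) → ∀ n x, ‖v n x‖ ≤ M :=
  GinzburgLandau.exists_smooth_approx hΩ (hχ.memLp_smul hΩ.measurableSet hf.1)
    hχ.2.1.smul_right ((tsupport_smul_subset_left χ f).trans hχ.2.2)
    (fun i => (hf.isWeakPartial i).smul_test hχ) fun i =>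
    (hχ.memLp_smul hΩ.measurableSet (hf.memLp_weakPartial hΩ i)).add
      ((hχ.partialDeriv i).memLp_smul hΩ.measurableSet hf.1)

/-- The chain rule for weak derivatives. -/
theorem MemW12.isWeakPartial_comp [CompleteSpace V] (hΩ : IsOpen Ω)
    (hb : Bornology.IsBounded Ω) (hf : MemW12 Ω f) {G : V → W} (hG : ContDiff ℝ 1 G)
    (hG0 : G 0 = 0) {L : ℝ≥0} (hL : ∀ z, ‖fderiv ℝ G z‖ ≤ L) (i : Fin 3) :
    MemLp (fun x => G (f x)) 2 (volume.restrict Ω) ∧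
    MemLp (fun x => fderiv ℝ G (f x) (weakPartial Ω i f x)) 2 (volume.restrict Ω) ∧
    IsWeakPartial Ω i (fun x => G (f x)) (fun x => fderiv ℝ G (f x) (weakPartial Ω i f x)) := by
  have hGl : LipschitzWith L G := lipschitzWith_of_nnnorm_fderiv_le
    (hG.differentiable one_ne_zero) hL
  have hGn : ∀ z, ‖G z‖ ≤ L * ‖z‖ := fun z => by
    simpa [hG0, dist_eq_norm] using hGl.dist_le_mul z 0
  have hDc : Continuous (fun z => fderiv ℝ G z) := hG.continuous_fderiv one_ne_zero
  have hDc2 : Continuous (fun p : V × V => fderiv ℝ G p.1 p.2) :=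
    (hDc.comp continuous_fst).clm_apply continuous_snd
  have mG : ∀ {μ : Measure E3} {w : E3 → V}, MemLp w 2 μ → MemLp (fun x => G (w x)) 2 μ :=
    fun hw => hw.of_le_mul (c := L) (hG.continuous.comp_aestronglyMeasurable hw.1)
      (Eventually.of_forall fun x => hGn _)
  have mD : ∀ {μ : Measure E3} {w z : E3 → V}, MemLp w 2 μ → MemLp z 2 μ →
      MemLp (fun x => fderiv ℝ G (w x) (z x)) 2 μ := fun hw hz =>
    hz.of_le_mul (c := L) (hDc2.comp_aestronglyMeasurable (hw.1.prodMk hz.1))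
      (Eventually.of_forall fun x => (ContinuousLinearMap.le_opNorm _ _).trans
        (mul_le_mul_of_nonneg_right (hL _) (norm_nonneg _)))
  have m1 := mG hf.1
  have m2 := mD hf.1 (hf.memLp_weakPartial hΩ i)
  refine ⟨m1, m2, isWeakPartial_of_integral_eq (MemLp.locallyIntegrableOn_of_restrict m1)
    (MemLp.locallyIntegrableOn_of_restrict m2) fun φ hφ => ?_⟩
  obtain ⟨δ, hδ, hδK⟩ := exists_pos_lt_infDist_compl hΩ hb hφ.2.1 hφ.2.2
  -- The identity for φ involves f only on the support of φ, where χ = 1 and ∇χ = 0. So f may be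
  -- replaced by χf, which has globally defined smooth approximations.
  obtain ⟨χ, hχ, -, -, -, hχ1, hχd⟩ := exists_cutoff (Ω := Ω) hb hδ
  obtain ⟨v, hv, hvc, -, hvae, hv2, hvd, -⟩ := hf.exists_smooth_approx hΩ hχ
  set u : E3 → V := fun x => χ x • f x with hu
  set g : E3 → V := fun x => χ x • weakPartial Ω i f x + partialDeriv i χ x • f x with hg
  have hu2 : MemLp u 2 volume := hχ.memLp_smul hΩ.measurableSet hf.1
  have hg2 : MemLp g 2 volume := (hχ.memLp_smul hΩ.measurableSet (hf.memLp_weakPartial hΩ i)).add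
      ((hχ.partialDeriv i).memLp_smul hΩ.measurableSet hf.1)
  have hvm : ∀ n, MemLp (v n) 2 volume := fun n =>
    (hv n).continuous.memLp_of_hasCompactSupport (hvc n)
  set dv : ℕ → E3 → V := fun n x => fderiv ℝ (v n) x (EuclideanSpace.single i 1) with hdv
  have hdvm : ∀ n, MemLp (dv n) 2 volume := fun n =>
    (((hv n).continuous_fderiv (by simp)).clm_apply continuous_const).memLp_of_hasCompactSupport
      ((hvc n).fderiv_apply ℝ _)
  have heq : ∀ n, ∫ x, partialDeriv i φ x • G (v n x)
      = - ∫ x, φ x • fderiv ℝ G (v n x) (dv n x) := fun n => by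
    have h := (isWeakPartial_of_contDiff (U := Ω) (i := i)
      (hG.comp ((hv n).of_le (by simp)))).integral_eq hφ
    refine h.trans (congrArg _ (integral_congr_ae (Eventually.of_forall fun x => ?_)))
    simp only
    rw [fderiv_comp x (hG.differentiable one_ne_zero _) ((hv n).differentiable (by simp) x)]
    rfl
  have lim1 : Tendsto (fun n => ∫ x, partialDeriv i φ x • G (v n x)) atTop
      (𝓝 (∫ x, partialDeriv i φ x • G (u x))) := by
    refine tendsto_integral_smul_of_eLpNorm_two (hφ.partialDeriv i).memLp (fun n => mG (hvm n))
      (mG hu2) ?_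
    refine tendsto_of_tendsto_of_tendsto_of_le_of_le tendsto_const_nhds
      (h := fun n => (L : ℝ≥0∞) * eLpNorm (v n - u) 2 volume) ?_ (fun _ => zero_le) fun n => ?_
    · simpa using ENNReal.Tendsto.const_mul hv2 (Or.inr (by simp))
    · refine eLpNorm_le_nnreal_smul_eLpNorm_of_ae_le_mul (Eventually.of_forall fun x => ?_) 2
      have := hGl.dist_le_mul (v n x) (u x)
      rw [dist_eq_norm, dist_eq_norm] at this
      exact_mod_cast this
  have lim2 : Tendsto (fun n => ∫ x, φ x • fderiv ℝ G (v n x) (dv n x)) atTop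
      (𝓝 (∫ x, φ x • fderiv ℝ G (u x) (g x))) := by
    refine tendsto_integral_smul_of_eLpNorm_two hφ.memLp (fun n => mD (hvm n) (hdvm n))
      (mD hu2 hg2) ?_
    -- The difference DG(v)dv - DG(u)g splits into DG(v)(dv - g), small since DG is bounded, and
    -- (DG(v) - DG(u))g, which needs dominated convergence because DG is merely continuous.
    have t1 : Tendsto (fun n => (L : ℝ≥0∞) * eLpNorm (dv n - g) 2 volume) atTop (𝓝 0) := by
      simpa using ENNReal.Tendsto.const_mul (hvd i) (Or.inr (by simp))
    have t2 : Tendsto (fun n => eLpNorm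
        (fun x => fderiv ℝ G (v n x) (g x) - fderiv ℝ G (u x) (g x)) 2 volume)
        atTop (𝓝 0) := by
      refine tendsto_eLpNorm_two_of_dominated (h := fun x => 2 * L * ‖g x‖)
        (fun n => ((mD (hvm n) hg2).sub (mD hu2 hg2)).1) (hg2.norm.const_mul _)
        (fun n => Eventually.of_forall fun x => ?_) ?_
      · have b : ∀ z, ‖fderiv ℝ G z (g x)‖ ≤ L * ‖g x‖ := fun z =>
          (ContinuousLinearMap.le_opNorm _ _).trans
            (mul_le_mul_of_nonneg_right (hL _) (norm_nonneg _))
        have := norm_sub_le (fderiv ℝ G (v n x) (g x)) (fderiv ℝ G (u x) (g x))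
        linarith [b (v n x), b (u x)]
      · filter_upwards [hvae] with x hx
        have h3 : Tendsto (fun n => fderiv ℝ G (v n x) (g x)) atTop
            (𝓝 (fderiv ℝ G (u x) (g x))) :=
          ((hDc.clm_apply continuous_const).tendsto (u x)).comp hx
        simpa using h3.sub_const (fderiv ℝ G (u x) (g x))
    have t3 := t1.add t2
    rw [add_zero] at t3
    refine tendsto_of_tendsto_of_tendsto_of_le_of_le tendsto_const_nhds t3 (fun _ => zero_le)
      fun n => ?_
    have e : ((fun x => fderiv ℝ G (v n x) (dv n x)) - fun x => fderiv ℝ G (u x) (g x))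
        = (fun x => fderiv ℝ G (v n x) ((dv n - g) x))
          + fun x => fderiv ℝ G (v n x) (g x) - fderiv ℝ G (u x) (g x) := by
      ext x
      simp
    simp only [e]
    refine (eLpNorm_add_le (mD (hvm n) ((hdvm n).sub hg2)).1
      ((mD (hvm n) hg2).sub (mD hu2 hg2)).1 (by norm_num)).trans ?_
    refine add_le_add_left ?_ _
    exact eLpNorm_le_nnreal_smul_eLpNorm_of_ae_le_mul (Eventually.of_forall fun x =>
      (ContinuousLinearMap.le_opNorm _ _).trans
        (mul_le_mul_of_nonneg_right (hL _) (norm_nonneg _))) 2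
  have hlim := tendsto_nhds_unique (lim1.congr heq) lim2.neg
  have e1 : ∫ x, partialDeriv i φ x • G (f x) = ∫ x, partialDeriv i φ x • G (u x) := by
    congr 1
    ext x
    by_cases hx : x ∈ tsupport φ
    · rw [hu]
      simp only [hχ1 x (hδK x hx).le, one_smul]
    · have : partialDeriv i φ x = 0 := image_eq_zero_of_notMem_tsupport fun h =>
        hx (tsupport_fderiv_apply_subset ℝ _ h)
      simp [this]
  have e2 : ∫ x, φ x • fderiv ℝ G (f x) (weakPartial Ω i f x)
      = ∫ x, φ x • fderiv ℝ G (u x) (g x) := by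
    congr 1
    ext x
    by_cases hx : x ∈ tsupport φ
    · rw [hu, hg]
      simp only [hχ1 x (hδK x hx).le, one_smul, hχd i x (hδK x hx), zero_smul, add_zero]
    · simp [image_eq_zero_of_notMem_tsupport hx]
  rw [e1, e2, hlim]

end Sobolev

/-! ### The magnetic lower bound -/

theorem partialDeriv_comm {f : E3 → ℝ} (hf : ContDiff ℝ ∞ f) (i j : Fin 3) (x : E3) :
    partialDeriv i (partialDeriv j f) x = partialDeriv j (partialDeriv i f) x := by
  have hd : DifferentiableAt ℝ (fderiv ℝ f) x :=
    ((hf.fderiv_right (m := ∞) (by simp)).differentiable (by simp)) x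
  have e : ∀ i j : Fin 3, partialDeriv i (partialDeriv j f) x
      = fderiv ℝ (fderiv ℝ f) x (EuclideanSpace.single i 1) (EuclideanSpace.single j 1) := by
    intro i j
    have h := (hd.hasFDerivAt.clm_apply (hasFDerivAt_const (EuclideanSpace.single j (1 : ℝ)) x))
    unfold partialDeriv
    rw [HasFDerivAt.fderiv (f := fun x => fderiv ℝ f x (EuclideanSpace.single j 1)) h]
    simp
  rw [e, e]
  exact ((hf.of_le (m := 2) ENat.LEInfty.out).contDiffAt.isSymmSndFDerivAt (by simp)).eq _ _

/-- Integrating by parts puts both derivatives on g, where they commute. Consequently the Jacobian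
of two test functions has integral zero. -/
theorem integral_partialDeriv_mul_partialDeriv_comm {f g : E3 → ℝ} {U : Set E3}
    (hf : IsTestFunction U f) (hg : IsTestFunction U g) (i j : Fin 3) :
    ∫ x, partialDeriv i f x * partialDeriv j g x = ∫ x, partialDeriv j f x * partialDeriv i g x := by
  have h : ∀ i j, ∫ x, partialDeriv i f x * partialDeriv j g x
      = - ∫ x, f x * partialDeriv i (partialDeriv j g) x := fun i j =>
    (isWeakPartial_of_contDiff (U := U) (i := i)
      ((contDiff_partialDeriv (i := j) hg.1).of_le (by simp))).integral_eq hf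
  rw [h, h]
  simp only [partialDeriv_comm hg.1 i j]

theorem IsTestFunction.integrable_mul_partialDeriv {f g : E3 → ℝ} {U : Set E3}
    (hf : IsTestFunction U f) (hg : IsTestFunction U g) (i j : Fin 3) :
    Integrable (fun x => GinzburgLandau.partialDeriv i f x * GinzburgLandau.partialDeriv j g x) :=
  (hf.partialDeriv i).integrable_smul
    ((contDiff_partialDeriv hg.1).continuous.locallyIntegrable.locallyIntegrableOn _)

theorem norm_add_mul_I_sq (p q : ℝ) : ‖(p + q * Complex.I : ℂ)‖ ^ 2 = p ^ 2 + q ^ 2 := by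
  rw [← Complex.normSq_eq_norm_sq, Complex.normSq_add_mul_I]

/-- With P₀u, P₁u the two momentum components, |P₀u - iP₁u|² ≥ 0. Its cross terms are a Jacobian of
the real and imaginary parts, which integrates to zero, and B times ∂₀|u|² a₁ - ∂₁|u|² a₀. The
latter is integrated by parts with |u|² as test function, so the potential needs no more than weak
derivatives. -/
theorem magnetic_lower_bound_of_contDiff {Ω : Set E3} {a₀ a₁ d₀ d₁ : E3 → ℝ}
    (h₀ : IsWeakPartial Ω 1 a₀ d₀) (h₁ : IsWeakPartial Ω 0 a₁ d₁)
    (ha₀ : MemLp a₀ 2 (volume.restrict Ω)) (ha₁ : MemLp a₁ 2 (volume.restrict Ω)) (B : ℝ)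
    {u : E3 → ℂ} (hu : ContDiff ℝ ∞ u) (hc : HasCompactSupport u) (hs : tsupport u ⊆ Ω) :
    B * ∫ x in Ω, (d₁ x - d₀ x) * ‖u x‖ ^ 2 ≤
      (∫ x in Ω, ‖-Complex.I * fderiv ℝ u x (EuclideanSpace.single 0 1)
        + ((B * a₀ x : ℝ) : ℂ) * u x‖ ^ 2)
      + ∫ x in Ω, ‖-Complex.I * fderiv ℝ u x (EuclideanSpace.single 1 1)
        + ((B * a₁ x : ℝ) : ℂ) * u x‖ ^ 2 := by
  set a : E3 → ℝ := fun x => (u x).re with ha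
  set b : E3 → ℝ := fun x => (u x).im with hb
  have hat : IsTestFunction Ω a := ⟨Complex.reCLM.contDiff.comp hu,
    hc.comp_left (g := Complex.re) rfl,
    (tsupport_comp_subset (g := Complex.re) rfl u).trans hs⟩
  have hbt : IsTestFunction Ω b := ⟨Complex.imCLM.contDiff.comp hu,
    hc.comp_left (g := Complex.im) rfl,
    (tsupport_comp_subset (g := Complex.im) rfl u).trans hs⟩
  have hd : ∀ i x, fderiv ℝ u x (EuclideanSpace.single i 1)
      = (partialDeriv i a x : ℂ) + (partialDeriv i b x : ℂ) * Complex.I := fun i x => by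
    have h := (hu.differentiable (by simp) x).hasFDerivAt
    have h1 : HasFDerivAt a _ x := Complex.reCLM.hasFDerivAt.comp x h
    have h2 : HasFDerivAt b _ x := Complex.imCLM.hasFDerivAt.comp x h
    unfold partialDeriv
    rw [h1.fderiv, h2.fderiv]
    simp only [ContinuousLinearMap.comp_apply, Complex.reCLM_apply, Complex.imCLM_apply,
      Complex.re_add_im]
  have hux : ∀ x, u x = (a x : ℂ) + (b x : ℂ) * Complex.I := fun x => (Complex.re_add_im _).symm
  set p : Fin 3 → (E3 → ℝ) → E3 → ℝ := fun j w x => partialDeriv j b x + B * w x * a x with hp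
  set q : Fin 3 → (E3 → ℝ) → E3 → ℝ := fun j w x => -partialDeriv j a x + B * w x * b x with hq
  have hP : ∀ j (w : E3 → ℝ) x, -Complex.I * fderiv ℝ u x (EuclideanSpace.single j 1)
      + ((B * w x : ℝ) : ℂ) * u x = (p j w x : ℂ) + (q j w x : ℂ) * Complex.I := fun j w x => by
    rw [hd, hux, hp, hq]
    push_cast
    linear_combination (-(partialDeriv j b x : ℂ)) * Complex.I_sq
  have hPn : ∀ j (w : E3 → ℝ) x, ‖-Complex.I * fderiv ℝ u x (EuclideanSpace.single j 1)
      + ((B * w x : ℝ) : ℂ) * u x‖ ^ 2 = p j w x ^ 2 + q j w x ^ 2 := fun j w x => by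
    rw [hP, norm_add_mul_I_sq]
  have hφ : IsTestFunction Ω (fun x => a x * a x + b x * b x) := by
    have h1 := hat.mul_right hat.1
    have h2 := hbt.mul_right hbt.1
    exact ⟨h1.1.add h2.1, h1.2.1.add h2.2.1,
      (tsupport_add _ _).trans (Set.union_subset h1.2.2 h2.2.2)⟩
  have hφn : ∀ x, ‖u x‖ ^ 2 = a x * a x + b x * b x := fun x => by
    rw [hux, norm_add_mul_I_sq, sq, sq]
  have hφd : ∀ i x, partialDeriv i (fun x => a x * a x + b x * b x) x
      = 2 * (a x * partialDeriv i a x + b x * partialDeriv i b x) := fun i x => by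
    have h1 : partialDeriv i (fun x => a x * a x + b x * b x) x
        = partialDeriv i (fun x => a x * a x) x + partialDeriv i (fun x => b x * b x) x := by
      unfold partialDeriv
      rw [fderiv_fun_add (((hat.1.mul hat.1).differentiable (by simp)) x)
        (((hbt.1.mul hbt.1).differentiable (by simp)) x)]
      rfl
    rw [h1, partialDeriv_mul hat.1 hat.1, partialDeriv_mul hbt.1 hbt.1]
    ring
  have m2 : ∀ j {w : E3 → ℝ}, MemLp w 2 (volume.restrict Ω) →
      MemLp (p j w) 2 (volume.restrict Ω) ∧ MemLp (q j w) 2 (volume.restrict Ω) := by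
    intro j w hw
    obtain ⟨M, hM⟩ := hat.2.1.exists_bound_of_continuous hat.1.continuous
    obtain ⟨N, hN⟩ := hbt.2.1.exists_bound_of_continuous hbt.1.continuous
    have k : ∀ {c : E3 → ℝ} {M : ℝ}, Continuous c → (∀ x, ‖c x‖ ≤ M) →
        MemLp (fun x => B * w x * c x) 2 (volume.restrict Ω) := fun {c M} hcc hcM =>
      (hw.const_mul B).of_le_mul (c := M)
        ((hw.1.const_mul B).mul hcc.aestronglyMeasurable) (Eventually.of_forall fun x => by
          rw [norm_mul, mul_comm]
          exact mul_le_mul_of_nonneg_right (hcM x) (norm_nonneg _))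
    exact ⟨((hbt.partialDeriv j).memLp.restrict Ω).add (k hat.1.continuous hM),
      ((hat.partialDeriv j).memLp.restrict Ω).neg.add (k hbt.1.continuous hN)⟩
  have i2 : ∀ j {w : E3 → ℝ}, MemLp w 2 (volume.restrict Ω) →
      Integrable (fun x => p j w x ^ 2 + q j w x ^ 2) (volume.restrict Ω) := fun j w hw =>
    (m2 j hw).1.integrable_sq.add (m2 j hw).2.integrable_sq
  set c : E3 → ℝ := fun x => partialDeriv 0 b x * partialDeriv 1 a x
    - partialDeriv 0 a x * partialDeriv 1 b x with hcdef
  have ic : Integrable c := (hbt.integrable_mul_partialDeriv hat 0 1).sub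
    (hat.integrable_mul_partialDeriv hbt 0 1)
  have ec : ∫ x, c x = 0 := by
    rw [hcdef, integral_sub (hbt.integrable_mul_partialDeriv hat 0 1)
      (hat.integrable_mul_partialDeriv hbt 0 1),
      integral_partialDeriv_mul_partialDeriv_comm hbt hat 0 1, sub_eq_zero]
    simp only [mul_comm]
  have ecΩ : ∫ x in Ω, c x = 0 := by
    rw [← ec]
    refine setIntegral_eq_integral_of_forall_compl_eq_zero fun x hx => ?_
    rw [hcdef]
    simp [(hat.partialDeriv 0).eq_zero hx, (hat.partialDeriv 1).eq_zero hx]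
  have w1 := h₁.2.2 _ hφ
  have w0 := h₀.2.2 _ hφ
  simp only [smul_eq_mul] at w1 w0
  set φ : E3 → ℝ := fun x => a x * a x + b x * b x with hφdef
  have i11 : Integrable (fun x => partialDeriv 0 φ x * a₁ x) (volume.restrict Ω) :=
    ((hφ.partialDeriv 0).integrable_smul h₁.1).integrableOn
  have i00 : Integrable (fun x => partialDeriv 1 φ x * a₀ x) (volume.restrict Ω) :=
    ((hφ.partialDeriv 1).integrable_smul h₀.1).integrableOn
  have j1 : Integrable (fun x => φ x * d₁ x) (volume.restrict Ω) :=
    (hφ.integrable_smul h₁.2.1).integrableOn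
  have j0 : Integrable (fun x => φ x * d₀ x) (volume.restrict Ω) :=
    (hφ.integrable_smul h₀.2.1).integrableOn
  simp only [hPn, hφn]
  have key : ∀ x, 0 ≤ (p 0 a₀ x ^ 2 + q 0 a₀ x ^ 2) + (p 1 a₁ x ^ 2 + q 1 a₁ x ^ 2)
      - (2 * c x - B * (partialDeriv 0 φ x * a₁ x - partialDeriv 1 φ x * a₀ x)) := fun x => by
    have : (p 0 a₀ x ^ 2 + q 0 a₀ x ^ 2) + (p 1 a₁ x ^ 2 + q 1 a₁ x ^ 2)
      - (2 * c x - B * (partialDeriv 0 φ x * a₁ x - partialDeriv 1 φ x * a₀ x))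
      -- The squares of the real and imaginary parts of P₀u - iP₁u. The terms quadratic in B drop
      -- out of the cross product.
      = (p 0 a₀ x + q 1 a₁ x) ^ 2 + (q 0 a₀ x - p 1 a₁ x) ^ 2 := by
      rw [hφd, hφd, hcdef, hp, hq]
      ring
    rw [this]
    positivity
  have hint : 0 ≤ ∫ x in Ω, ((p 0 a₀ x ^ 2 + q 0 a₀ x ^ 2) + (p 1 a₁ x ^ 2 + q 1 a₁ x ^ 2)
      - (2 * c x - B * (partialDeriv 0 φ x * a₁ x - partialDeriv 1 φ x * a₀ x))) :=
    integral_nonneg fun x => key x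
  rw [integral_sub, integral_add (i2 0 ha₀) (i2 1 ha₁), integral_sub, integral_const_mul,
    integral_const_mul, integral_sub i11 i00, ecΩ, w1, w0] at hint
  · have e : ∫ x in Ω, (d₁ x - d₀ x) * φ x
        = (∫ x in Ω, φ x * d₁ x) - ∫ x in Ω, φ x * d₀ x := by
      rw [← integral_sub j1 j0]
      congr 1
      ext x
      ring
    rw [e]
    linarith
  · exact (ic.integrableOn).const_mul 2
  · exact (i11.sub i00).const_mul B
  · exact (i2 0 ha₀).add (i2 1 ha₁)
  · exact ((ic.integrableOn).const_mul 2).sub ((i11.sub i00).const_mul B)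

/-- Passage to the limit from mollifications of χψ. The bound |χψ| ≤ 1 is inherited by the
approximations and makes dominated convergence work with a potential only in L² and a field only in
L¹. -/
theorem magnetic_lower_bound {Ω : Set E3} (hΩ : IsOpen Ω) {a₀ a₁ d₀ d₁ : E3 → ℝ}
    (h₀ : IsWeakPartial Ω 1 a₀ d₀) (h₁ : IsWeakPartial Ω 0 a₁ d₁)
    (ha₀ : MemLp a₀ 2 (volume.restrict Ω)) (ha₁ : MemLp a₁ 2 (volume.restrict Ω))
    (hd : IntegrableOn (fun x => d₁ x - d₀ x) Ω) (B : ℝ)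
    {ψ : E3 → ℂ} (hψ : MemW12 Ω ψ) {χ : E3 → ℝ} (hχ : IsTestFunction Ω χ)
    (hbd : ∀ᵐ x, ‖χ x • ψ x‖ ≤ 1) :
    B * ∫ x in Ω, (d₁ x - d₀ x) * ‖χ x • ψ x‖ ^ 2 ≤
      (∫ x in Ω, ‖-Complex.I * (χ x • weakPartial Ω 0 ψ x + partialDeriv 0 χ x • ψ x)
        + ((B * a₀ x : ℝ) : ℂ) * (χ x • ψ x)‖ ^ 2)
      + ∫ x in Ω, ‖-Complex.I * (χ x • weakPartial Ω 1 ψ x + partialDeriv 1 χ x • ψ x)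
        + ((B * a₁ x : ℝ) : ℂ) * (χ x • ψ x)‖ ^ 2 := by
  obtain ⟨v, hv, hvc, hvs, hvae, -, hvd, hvb⟩ := hψ.exists_smooth_approx hΩ hχ
  have hv1 := hvb 1 hbd
  have hum : AEStronglyMeasurable (fun x => χ x • ψ x) (volume.restrict Ω) :=
    (hχ.memLp_smul hΩ.measurableSet hψ.1).1.restrict
  have hvm : ∀ n, AEStronglyMeasurable (v n) (volume.restrict Ω) := fun n =>
    (hv n).continuous.aestronglyMeasurable
  have hvaeΩ := ae_restrict_of_ae (s := Ω) hvae
  have hbdΩ := ae_restrict_of_ae (s := Ω) hbd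
  have lhs : Tendsto (fun n => B * ∫ x in Ω, (d₁ x - d₀ x) * ‖v n x‖ ^ 2) atTop
      (𝓝 (B * ∫ x in Ω, (d₁ x - d₀ x) * ‖χ x • ψ x‖ ^ 2)) := by
    refine Tendsto.const_mul B (tendsto_integral_of_dominated_convergence
      (fun x => ‖d₁ x - d₀ x‖) (fun n => hd.1.mul ((hvm n).norm.pow 2)) hd.norm
      (fun n => Eventually.of_forall fun x => ?_) ?_)
    · rw [norm_mul, norm_pow, norm_norm]
      exact mul_le_of_le_one_right (norm_nonneg _) (pow_le_one₀ (norm_nonneg _) (hv1 n x))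
    · filter_upwards [hvaeΩ] with x hx
      exact (hx.norm.pow 2).const_mul _
  have rhs : ∀ (j : Fin 3) {w : E3 → ℝ}, MemLp w 2 (volume.restrict Ω) →
      Tendsto (fun n => ∫ x in Ω, ‖-Complex.I * fderiv ℝ (v n) x (EuclideanSpace.single j 1)
        + ((B * w x : ℝ) : ℂ) * v n x‖ ^ 2) atTop
      (𝓝 (∫ x in Ω, ‖-Complex.I * (χ x • weakPartial Ω j ψ x + partialDeriv j χ x • ψ x)
        + ((B * w x : ℝ) : ℂ) * (χ x • ψ x)‖ ^ 2)) := by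
    intro j w hw
    have hBw : MemLp (fun x => ((B * w x : ℝ) : ℂ)) 2 (volume.restrict Ω) :=
      (hw.const_mul B).ofReal
    set g : E3 → ℂ := fun x => χ x • weakPartial Ω j ψ x + partialDeriv j χ x • ψ x with hg
    have hgm : MemLp g 2 volume :=
      (hχ.memLp_smul hΩ.measurableSet (hψ.memLp_weakPartial hΩ j)).add
        ((hχ.partialDeriv j).memLp_smul hΩ.measurableSet hψ.1)
    set dv : ℕ → E3 → ℂ := fun n x => fderiv ℝ (v n) x (EuclideanSpace.single j 1) with hdv
    have hdvm : ∀ n, MemLp (dv n) 2 volume := fun n =>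
      (((hv n).continuous_fderiv (by simp)).clm_apply continuous_const).memLp_of_hasCompactSupport
        ((hvc n).fderiv_apply ℝ _)
    have k : ∀ {z : E3 → ℂ}, AEStronglyMeasurable z (volume.restrict Ω) →
        (∀ᵐ x ∂(volume.restrict Ω), ‖z x‖ ≤ 1) →
        MemLp (fun x => ((B * w x : ℝ) : ℂ) * z x) 2 (volume.restrict Ω) := fun hz hz1 =>
      hBw.mono (hBw.1.mul hz) (hz1.mono fun x hx => by
        rw [norm_mul]
        exact mul_le_of_le_one_right (norm_nonneg _) hx)
    have kn := fun n => k (hvm n) (Eventually.of_forall (hv1 n))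
    have k0 := k hum hbdΩ
    refine tendsto_integral_norm_sq
      (fun n => (((hdvm n).restrict Ω).const_mul (-Complex.I)).add (kn n))
      (((hgm.restrict Ω).const_mul (-Complex.I)).add k0) ?_
    have t1 : Tendsto (fun n => eLpNorm (dv n - g) 2 volume) atTop (𝓝 0) := hvd j
    have t2 : Tendsto (fun n => eLpNorm (fun x => ((B * w x : ℝ) : ℂ) * v n x
        - ((B * w x : ℝ) : ℂ) * (χ x • ψ x)) 2 (volume.restrict Ω)) atTop (𝓝 0) := by
      refine tendsto_eLpNorm_two_of_dominated (h := fun x => 2 * ‖((B * w x : ℝ) : ℂ)‖)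
        (fun n => ((kn n).sub k0).1) (hBw.norm.const_mul 2) (fun n => ?_) ?_
      · filter_upwards [hbdΩ] with x hx
        rw [← mul_sub, norm_mul, mul_comm]
        refine mul_le_mul_of_nonneg_right ?_ (norm_nonneg _)
        have := norm_sub_le (v n x) (χ x • ψ x)
        linarith [hv1 n x]
      · filter_upwards [hvaeΩ] with x hx
        have := (hx.const_mul ((B * w x : ℝ) : ℂ)).sub_const (((B * w x : ℝ) : ℂ) * (χ x • ψ x))
        rwa [sub_self] at this
    have t3 := t1.add t2
    rw [add_zero] at t3
    refine tendsto_of_tendsto_of_tendsto_of_le_of_le tendsto_const_nhds t3 (fun _ => zero_le)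
      fun n => ?_
    have e : ((fun x => -Complex.I * dv n x + ((B * w x : ℝ) : ℂ) * v n x)
        - fun x => -Complex.I * g x + ((B * w x : ℝ) : ℂ) * (χ x • ψ x))
        = (fun x => -Complex.I * (dv n - g) x) + fun x => ((B * w x : ℝ) : ℂ) * v n x
        - ((B * w x : ℝ) : ℂ) * (χ x • ψ x) := by
      funext x
      simp only [Pi.sub_apply, Pi.add_apply]
      ring
    change eLpNorm ((fun x => -Complex.I * dv n x + ((B * w x : ℝ) : ℂ) * v n x)
        - fun x => -Complex.I * g x + ((B * w x : ℝ) : ℂ) * (χ x • ψ x)) 2 _ ≤ _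
    rw [e]
    refine (eLpNorm_add_le ((((hdvm n).sub hgm).restrict Ω).const_mul (-Complex.I)).1
      ((kn n).sub k0).1 (by norm_num)).trans (add_le_add_left ?_ _)
    have : eLpNorm (fun x => -Complex.I * (dv n - g) x) 2 (volume.restrict Ω)
        = eLpNorm (dv n - g) 2 (volume.restrict Ω) :=
      eLpNorm_congr_norm_ae (Eventually.of_forall fun x => by simp)
    rw [this]
    exact eLpNorm_mono_measure _ Measure.restrict_le_self
  exact le_of_tendsto_of_tendsto' lhs ((rhs 0 ha₀).add (rhs 1 ha₁)) fun n =>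
    magnetic_lower_bound_of_contDiff h₀ h₁ ha₀ ha₁ B (hv n) (hvc n) (hvs n)

/-! ### The energy in terms of real integrals -/

theorem magneticMomentum_apply (Ω : Set E3) (B : ℝ) (A : E3 → E3) (ψ : E3 → ℂ) (x : E3)
    (j : Fin 3) : magneticMomentum Ω B A ψ x j
      = -Complex.I * weakPartial Ω j ψ x + ((B * A x j : ℝ) : ℂ) * ψ x := rfl

theorem lintegral_ofReal_of_integrable {α : Type*} [MeasurableSpace α] {μ : Measure α}
    {f : α → ℝ} {F : α → ℝ≥0∞} (hf : Integrable f μ) (h0 : ∀ x, 0 ≤ f x)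
    (h : ∀ x, F x = ENNReal.ofReal (f x)) : ∫⁻ x, F x ∂μ = ENNReal.ofReal (∫ x, f x ∂μ) := by
  rw [ofReal_integral_eq_lintegral_ofReal hf (Eventually.of_forall h0)]
  simp only [h]

theorem enorm_pow_eq_ofReal {V : Type*} [NormedAddCommGroup V] (v : V) (n : ℕ) :
    ‖v‖ₑ ^ n = ENNReal.ofReal (‖v‖ ^ n) := by
  rw [ENNReal.ofReal_pow (norm_nonneg _), ofReal_norm]

theorem MemLp.integrable_norm_four {α V : Type*} [MeasurableSpace α] {μ : Measure α}
    [NormedAddCommGroup V] {f : α → V} (hf : MemLp f 4 μ) :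
    Integrable (fun x => ‖f x‖ ^ 4) μ :=
  MeasureTheory.MemLp.integrable_norm_pow (p := 4) (by exact_mod_cast hf) (by norm_num)

/-- Once all terms are finite the energy is a real number whose magnetic term depends on A alone, so
that term cancels when only ψ is varied. -/
theorem energyWith_eq {D Ω : Set E3} {κ H : ℝ} {ψ : E3 → ℂ} {A : E3 → E3}
    (hP : ∀ j, MemLp (fun x => magneticMomentum Ω (κ * H) A ψ x j) 2 (volume.restrict Ω))
    (h2 : MemLp ψ 2 (volume.restrict Ω)) (h4 : MemLp ψ 4 (volume.restrict Ω))
    (hZ : ∫⁻ x in D, ‖weakCurl D A x - beta‖ₑ ^ 2 ≠ ⊤) :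
    energyWith D κ H Ω ψ A = (((∫ x in Ω, ((∑ j, ‖magneticMomentum Ω (κ * H) A ψ x j‖ ^ 2)
      + κ ^ 2 / 2 * ‖ψ x‖ ^ 4 - κ ^ 2 * ‖ψ x‖ ^ 2))
      + κ ^ 2 * H ^ 2 * (∫⁻ x in D, ‖weakCurl D A x - beta‖ₑ ^ 2).toReal : ℝ) : EReal) := by
  have iP : Integrable (fun x => ∑ j, ‖magneticMomentum Ω (κ * H) A ψ x j‖ ^ 2)
      (volume.restrict Ω) := integrable_finsetSum _ fun j _ => (hP j).norm.integrable_sq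
  have i4 := MemLp.integrable_norm_four h4
  have i2 := h2.norm.integrable_sq
  set Z := ∫⁻ x in D, ‖weakCurl D A x - beta‖ₑ ^ 2 with hZdef
  have e1 : ∫⁻ x in Ω, ‖magneticMomentum Ω (κ * H) A ψ x‖ₑ ^ 2
      = ENNReal.ofReal (∫ x in Ω, ∑ j, ‖magneticMomentum Ω (κ * H) A ψ x j‖ ^ 2) :=
    lintegral_ofReal_of_integrable iP (fun x => by positivity) fun x => by
      rw [enorm_pow_eq_ofReal, EuclideanSpace.norm_sq_eq]
  have e2 : ∫⁻ x in Ω, ‖ψ x‖ₑ ^ 4 = ENNReal.ofReal (∫ x in Ω, ‖ψ x‖ ^ 4) :=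
    lintegral_ofReal_of_integrable i4 (fun x => by positivity) fun x => enorm_pow_eq_ofReal _ _
  have n1 : 0 ≤ ∫ x in Ω, ∑ j, ‖magneticMomentum Ω (κ * H) A ψ x j‖ ^ 2 :=
    integral_nonneg fun x => by positivity
  have n2 : 0 ≤ ∫ x in Ω, ‖ψ x‖ ^ 4 := integral_nonneg fun x => by positivity
  have n3 : 0 ≤ Z.toReal := ENNReal.toReal_nonneg
  have i3 : Integrable (fun x => (∑ j, ‖magneticMomentum Ω (κ * H) A ψ x j‖ ^ 2)
      + κ ^ 2 / 2 * ‖ψ x‖ ^ 4) (volume.restrict Ω) := iP.add (i4.const_mul _)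
  rw [energyWith, e1, e2, ← hZdef]
  conv_lhs => rw [← ENNReal.ofReal_toReal hZ]
  rw [← ENNReal.ofReal_mul (by positivity), ← ENNReal.ofReal_mul (by positivity),
    ← ENNReal.ofReal_add n1 (by positivity), ← ENNReal.ofReal_add (by positivity) (by positivity),
    EReal.coe_ennreal_ofReal, max_eq_left (by positivity), ← EReal.coe_sub, EReal.coe_eq_coe_iff,
    integral_sub i3 (i2.const_mul _), integral_add iP (i4.const_mul _),
    integral_const_mul, integral_const_mul]
  ring

/-- Comparison with a state of energy at most `0`. -/
theorem lintegral_add_le_of_energyWith_nonpos {D Ω : Set E3} {κ H : ℝ} {ψ : E3 → ℂ} {A : E3 → E3}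
    (h : energyWith D κ H Ω ψ A ≤ 0) :
    (∫⁻ x in Ω, ‖magneticMomentum Ω (κ * H) A ψ x‖ₑ ^ 2)
      + ENNReal.ofReal (κ ^ 2 / 2) * (∫⁻ x in Ω, ‖ψ x‖ₑ ^ 4)
      + ENNReal.ofReal (κ ^ 2 * H ^ 2) * (∫⁻ x in D, ‖weakCurl D A x - beta‖ₑ ^ 2)
      ≤ ENNReal.ofReal (κ ^ 2 * ∫ x in Ω, ‖ψ x‖ ^ 2) := by
  rw [energyWith, EReal.sub_nonpos] at h
  have hn : 0 ≤ κ ^ 2 * ∫ x in Ω, ‖ψ x‖ ^ 2 :=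
    mul_nonneg (sq_nonneg _) (integral_nonneg fun x => by positivity)
  rw [← max_eq_left hn, ← EReal.coe_ennreal_ofReal] at h
  exact EReal.coe_ennreal_le_coe_ennreal_iff.1 h

/-! ### The Euler-Lagrange equation -/

theorem eq_zero_of_forall_nonneg {a b c d : ℝ}
    (h : ∀ t : ℝ, 0 ≤ a * t + b * t ^ 2 + c * t ^ 3 + d * t ^ 4) : a = 0 := by
  have hmin : IsLocalMin (fun t : ℝ => a * t + b * t ^ 2 + c * t ^ 3 + d * t ^ 4) 0 :=
    Eventually.of_forall fun t => by simpa using h t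
  have hd : HasDerivAt (fun t : ℝ => a * t + b * t ^ 2 + c * t ^ 3 + d * t ^ 4)
      (a * 1 + b * (2 * 0 ^ 1) + c * (3 * 0 ^ 2) + d * (4 * 0 ^ 3)) 0 := by
    have := ((((hasDerivAt_id (0 : ℝ)).const_mul a).add ((hasDerivAt_pow 2 (0 : ℝ)).const_mul b)).add
      ((hasDerivAt_pow 3 (0 : ℝ)).const_mul c)).add ((hasDerivAt_pow 4 (0 : ℝ)).const_mul d)
    refine HasDerivAt.congr_deriv this ?_
    norm_num
  simpa using hmin.hasDerivAt_eq_zero hd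

theorem norm_add_smul_sq (p q : ℂ) (t : ℝ) : ‖p + t • q‖ ^ 2
    = ‖p‖ ^ 2 + t * (2 * (starRingEnd ℂ p * q).re) + t ^ 2 * ‖q‖ ^ 2 := by
  simp only [Complex.sq_norm, Complex.normSq_apply, Complex.add_re, Complex.add_im,
    Complex.real_smul, Complex.mul_re, Complex.mul_im, Complex.ofReal_re, Complex.ofReal_im,
    Complex.conj_re, Complex.conj_im]
  ring

theorem integrable_re_conj_mul {α : Type*} [MeasurableSpace α] {μ : Measure α} {p q : α → ℂ}
    (hp : MemLp p 2 μ) (hq : MemLp q 2 μ) :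
    Integrable (fun x => (starRingEnd ℂ (p x) * q x).re) μ := by
  have h : Integrable (fun x => starRingEnd ℂ (p x) * q x) μ :=
    memLp_one_iff_integrable.1 (hq.mul (r := 1) hp.star)
  exact h.re

/-- Along ψ + t gψ with g real and bounded the energy is a quartic polynomial in t with a minimum at
0, so its linear coefficient vanishes. The function q is the part of ∇(gψ) falling on g, whence the
momentum of gψ is g times that of ψ minus iq. Variations of this form keep all integrals finite
without any Sobolev embedding. -/
theorem euler_lagrange {D Ω : Set E3} (hΩ : IsOpen Ω) {κ H : ℝ} {ψ : E3 → ℂ} {A : E3 → E3}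
    (hψ : MemW12 Ω ψ)
    (hP : ∀ j, MemLp (fun x => magneticMomentum Ω (κ * H) A ψ x j) 2 (volume.restrict Ω))
    (h4 : MemLp ψ 4 (volume.restrict Ω))
    (hZ : ∫⁻ x in D, ‖weakCurl D A x - beta‖ₑ ^ 2 ≠ ⊤)
    (hmin : ∀ φ, MemW12 Ω φ → energyWith D κ H Ω ψ A ≤ energyWith D κ H Ω φ A)
    {g : E3 → ℝ} {M : ℝ} (hgm : AEStronglyMeasurable g (volume.restrict Ω))
    (hgM : ∀ x, ‖g x‖ ≤ M) {q : Fin 3 → E3 → ℂ}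
    (hq : ∀ j, IsWeakPartial Ω j (fun x => g x • ψ x)
      (fun x => g x • weakPartial Ω j ψ x + q j x))
    (hq2 : ∀ j, MemLp (q j) 2 (volume.restrict Ω)) :
    Integrable (fun x => (∑ j, (starRingEnd ℂ (magneticMomentum Ω (κ * H) A ψ x j)
        * (g x • magneticMomentum Ω (κ * H) A ψ x j - Complex.I * q j x)).re)
        + κ ^ 2 * (g x * ‖ψ x‖ ^ 4) - κ ^ 2 * (g x * ‖ψ x‖ ^ 2)) (volume.restrict Ω) ∧
    ∫ x in Ω, ((∑ j, (starRingEnd ℂ (magneticMomentum Ω (κ * H) A ψ x j)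
        * (g x • magneticMomentum Ω (κ * H) A ψ x j - Complex.I * q j x)).re)
        + κ ^ 2 * (g x * ‖ψ x‖ ^ 4) - κ ^ 2 * (g x * ‖ψ x‖ ^ 2)) = 0 := by
  set P : Fin 3 → E3 → ℂ := fun j x => magneticMomentum Ω (κ * H) A ψ x j with hPdef
  set Q : Fin 3 → E3 → ℂ := fun j x => g x • P j x - Complex.I * q j x with hQdef
  have gL : ∀ {p : ℝ≥0∞} {f : E3 → ℂ}, MemLp f p (volume.restrict Ω) →
      MemLp (fun x => g x • f x) p (volume.restrict Ω) := fun {p f} hf =>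
    hf.of_le_mul (c := M) (hgm.smul hf.1) (Eventually.of_forall fun x => by
      rw [norm_smul]
      exact mul_le_mul_of_nonneg_right (hgM x) (norm_nonneg _))
  have gI : ∀ {f : E3 → ℝ}, Integrable f (volume.restrict Ω) →
      Integrable (fun x => g x * f x) (volume.restrict Ω) := fun hf =>
    hf.bdd_mul hgm (Eventually.of_forall hgM)
  have hQ : ∀ j, MemLp (Q j) 2 (volume.restrict Ω) := fun j =>
    (gL (hP j)).sub ((hq2 j).const_mul Complex.I)
  have i2 := hψ.1.norm.integrable_sq
  have i4 := MemLp.integrable_norm_four h4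
  have iPQ : Integrable (fun x => ∑ j, (starRingEnd ℂ (P j x) * Q j x).re) (volume.restrict Ω) :=
    integrable_finsetSum _ fun j _ => integrable_re_conj_mul (hP j) (hQ j)
  have iP : Integrable (fun x => ∑ j, ‖P j x‖ ^ 2) (volume.restrict Ω) :=
    integrable_finsetSum _ fun j _ => (hP j).norm.integrable_sq
  have iQ : Integrable (fun x => ∑ j, ‖Q j x‖ ^ 2) (volume.restrict Ω) :=
    integrable_finsetSum _ fun j _ => (hQ j).norm.integrable_sq
  -- The energy density of ψ + t gψ, magnetic term aside, is f₀ + 2t f₁ + t² f₂ + t³ f₃ + t⁴ f₄. The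
  -- quartic coefficients come from (κ²/2)(1 + t g)⁴|ψ|⁴.
  set f₀ : E3 → ℝ := fun x => (∑ j, ‖P j x‖ ^ 2) + κ ^ 2 / 2 * ‖ψ x‖ ^ 4 - κ ^ 2 * ‖ψ x‖ ^ 2
  set f₁ : E3 → ℝ := fun x => (∑ j, (starRingEnd ℂ (P j x) * Q j x).re)
    + κ ^ 2 * (g x * ‖ψ x‖ ^ 4) - κ ^ 2 * (g x * ‖ψ x‖ ^ 2) with hf₁
  set f₂ : E3 → ℝ := fun x => (∑ j, ‖Q j x‖ ^ 2) + 3 * κ ^ 2 * (g x * (g x * ‖ψ x‖ ^ 4))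
    - κ ^ 2 * (g x * (g x * ‖ψ x‖ ^ 2))
  set f₃ : E3 → ℝ := fun x => 2 * κ ^ 2 * (g x * (g x * (g x * ‖ψ x‖ ^ 4)))
  set f₄ : E3 → ℝ := fun x => κ ^ 2 / 2 * (g x * (g x * (g x * (g x * ‖ψ x‖ ^ 4))))
  have I₀ : Integrable f₀ (volume.restrict Ω) := (iP.add (i4.const_mul _)).sub (i2.const_mul _)
  have I₁ : Integrable f₁ (volume.restrict Ω) :=
    (iPQ.add ((gI i4).const_mul _)).sub ((gI i2).const_mul _)
  have I₂ : Integrable f₂ (volume.restrict Ω) :=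
    (iQ.add ((gI (gI i4)).const_mul _)).sub ((gI (gI i2)).const_mul _)
  have I₃ : Integrable f₃ (volume.restrict Ω) := (gI (gI (gI i4))).const_mul _
  have I₄ : Integrable f₄ (volume.restrict Ω) := (gI (gI (gI (gI i4)))).const_mul _
  refine ⟨I₁, ?_⟩
  have key : ∀ t : ℝ, 0 ≤ 2 * (∫ x in Ω, f₁ x) * t + (∫ x in Ω, f₂ x) * t ^ 2
      + (∫ x in Ω, f₃ x) * t ^ 3 + (∫ x in Ω, f₄ x) * t ^ 4 := by
    intro t
    set φ : E3 → ℂ := fun x => ψ x + t • (g x • ψ x) with hφ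
    have hφw : ∀ j, IsWeakPartial Ω j φ (fun x => weakPartial Ω j ψ x
        + t • (g x • weakPartial Ω j ψ x + q j x)) := fun j =>
      (hψ.isWeakPartial j).add ((hq j).const_smul t)
    have hφm : MemW12 Ω φ := ⟨hψ.1.add ((gL hψ.1).const_smul t), fun j => ⟨_, hφw j,
      (hψ.memLp_weakPartial hΩ j).add
        (((gL (hψ.memLp_weakPartial hΩ j)).add (hq2 j)).const_smul t)⟩⟩
    have hφP : ∀ j, (fun x => magneticMomentum Ω (κ * H) A φ x j)
        =ᵐ[volume.restrict Ω] fun x => P j x + t • Q j x := fun j => by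
      filter_upwards [weakPartial_ae_eq hΩ (hφw j)] with x hx
      rw [magneticMomentum_apply, hx, hφ, hQdef, hPdef]
      simp only [magneticMomentum_apply, Complex.real_smul]
      ring
    have hφP2 : ∀ j, MemLp (fun x => magneticMomentum Ω (κ * H) A φ x j) 2
        (volume.restrict Ω) := fun j =>
      (memLp_congr_ae (hφP j)).2 ((hP j).add ((hQ j).const_smul t))
    have hφ4 : MemLp φ 4 (volume.restrict Ω) := h4.add ((gL h4).const_smul t)
    have hle := hmin φ hφm
    rw [energyWith_eq hP hψ.1 h4 hZ, energyWith_eq hφP2 hφm.1 hφ4 hZ, EReal.coe_le_coe_iff,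
      add_le_add_iff_right] at hle
    have e : ∫ x in Ω, ((∑ j, ‖magneticMomentum Ω (κ * H) A φ x j‖ ^ 2)
        + κ ^ 2 / 2 * ‖φ x‖ ^ 4 - κ ^ 2 * ‖φ x‖ ^ 2)
        = ∫ x in Ω, (f₀ x + (2 * t) * f₁ x + t ^ 2 * f₂ x + t ^ 3 * f₃ x + t ^ 4 * f₄ x) := by
      refine integral_congr_ae ?_
      filter_upwards [hφP 0, hφP 1, hφP 2] with x h0 h1 h2
      have hn : ‖φ x‖ = |1 + t * g x| * ‖ψ x‖ := by
        rw [← Real.norm_eq_abs, ← norm_smul, add_smul, one_smul, mul_smul]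
      have h4e : ‖φ x‖ ^ 4 = (1 + t * g x) ^ 4 * ‖ψ x‖ ^ 4 := by
        rw [hn, mul_pow, (show Even 4 by decide).pow_abs]
      have h2e : ‖φ x‖ ^ 2 = (1 + t * g x) ^ 2 * ‖ψ x‖ ^ 2 := by
        rw [hn, mul_pow, sq_abs]
      simp only [f₀, f₁, f₂, f₃, f₄, h4e, h2e, Fin.sum_univ_three]
      rw [h0, h1, h2, norm_add_smul_sq, norm_add_smul_sq, norm_add_smul_sq]
      ring
    have J₁ : Integrable (fun x => f₀ x + (2 * t) * f₁ x) (volume.restrict Ω) :=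
      I₀.add (I₁.const_mul _)
    have J₂ : Integrable (fun x => f₀ x + (2 * t) * f₁ x + t ^ 2 * f₂ x) (volume.restrict Ω) :=
      J₁.add (I₂.const_mul _)
    have J₃ : Integrable (fun x => f₀ x + (2 * t) * f₁ x + t ^ 2 * f₂ x + t ^ 3 * f₃ x)
      (volume.restrict Ω) := J₂.add (I₃.const_mul _)
    rw [e, integral_add J₃ (I₄.const_mul _), integral_add J₂ (I₃.const_mul _),
      integral_add J₁ (I₂.const_mul _), integral_add I₀ (I₁.const_mul _),
      integral_const_mul (2 * t) f₁, integral_const_mul (t ^ 2) f₂, integral_const_mul (t ^ 3) f₃,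
      integral_const_mul (t ^ 4) f₄] at hle
    have hle' : ∫ x in Ω, f₀ x ≤ _ := hle
    linarith
  have := eq_zero_of_forall_nonneg key
  linarith

/-! ### The maximum principle `|ψ| ≤ 1` -/

/-- The potential disappears from the h term: b is real, so its contribution -ihb|z|² is purely
imaginary. -/
theorem re_conj_mul_variation (d z : ℂ) (b g h : ℝ) :
    (starRingEnd ℂ (-Complex.I * d + (b : ℂ) * z)
      * (g • (-Complex.I * d + (b : ℂ) * z) - Complex.I * (h • z))).re
      = g * ‖-Complex.I * d + (b : ℂ) * z‖ ^ 2 + h * (z.re * d.re + z.im * d.im) := by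
  simp only [Complex.sq_norm, Complex.normSq_apply, Complex.add_re, Complex.add_im,
    Complex.real_smul, Complex.mul_re, Complex.mul_im, Complex.ofReal_re, Complex.ofReal_im,
    Complex.conj_re, Complex.conj_im, Complex.sub_re, Complex.sub_im, Complex.neg_re,
    Complex.neg_im, Complex.I_re, Complex.I_im]
  ring

theorem exists_abs_deriv_smoothTransition_le :
    ∃ C : ℝ, ∀ t, |deriv Real.smoothTransition t| ≤ C := by
  have hc : HasCompactSupport (deriv Real.smoothTransition) := by
    refine HasCompactSupport.intro (isCompact_Icc (a := (0 : ℝ)) (b := 1)) fun t ht => ?_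
    rw [Set.mem_Icc, not_and_or, not_le, not_le] at ht
    rcases ht with ht | ht
    · have h : Real.smoothTransition =ᶠ[𝓝 t] fun _ => 0 := by
        filter_upwards [Iio_mem_nhds ht] with s hs
        exact Real.smoothTransition.zero_of_nonpos (le_of_lt hs)
      rw [h.deriv_eq, deriv_const]
    · have h : Real.smoothTransition =ᶠ[𝓝 t] fun _ => 1 := by
        filter_upwards [Ioi_mem_nhds ht] with s hs
        exact Real.smoothTransition.one_of_one_le (le_of_lt hs)
      rw [h.deriv_eq, deriv_const]
  exact hc.exists_bound_of_continuous
    ((Real.smoothTransition.contDiff (n := 1)).continuous_deriv (by simp))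

theorem deriv_smoothTransition_eq_zero {t : ℝ} (ht : 1 < t) :
    deriv Real.smoothTransition t = 0 := by
  have h : Real.smoothTransition =ᶠ[𝓝 t] fun _ => 1 := by
    filter_upwards [Ioi_mem_nhds ht] with s hs
    exact Real.smoothTransition.one_of_one_le (le_of_lt hs)
  rw [h.deriv_eq, deriv_const]

/-- A smooth weight vanishing exactly on the unit disc. -/
def outerWeight (z : ℂ) : ℝ := Real.smoothTransition (z.re ^ 2 + z.im ^ 2 - 1)

/-- The factor of `z` in the derivative of `outerWeight z • z` in the direction `w`. -/
def outerWeightDeriv (z w : ℂ) : ℝ :=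
  deriv Real.smoothTransition (z.re ^ 2 + z.im ^ 2 - 1) * (2 * (z.re * w.re + z.im * w.im))

theorem contDiff_outerWeight : ContDiff ℝ 1 outerWeight :=
  (Real.smoothTransition.contDiff (n := 1)).comp
    (((Complex.reCLM.contDiff.pow 2).add (Complex.imCLM.contDiff.pow 2)).sub contDiff_const)

theorem contDiff_outerWeight_smul : ContDiff ℝ 1 fun z : ℂ => outerWeight z • z :=
  contDiff_outerWeight.smul contDiff_id

theorem fderiv_outerWeight_smul (z w : ℂ) :
    fderiv ℝ (fun z : ℂ => outerWeight z • z) z w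
      = outerWeight z • w + outerWeightDeriv z w • z := by
  have h1 : HasFDerivAt (fun z : ℂ => z.re ^ 2 + z.im ^ 2 - 1)
      ((2 * z.re) • Complex.reCLM + (2 * z.im) • Complex.imCLM) z := by
    refine HasFDerivAt.congr_fderiv (((Complex.reCLM.hasFDerivAt (x := z)).pow 2 |>.add
      ((Complex.imCLM.hasFDerivAt (x := z)).pow 2)).sub_const 1) ?_
    ext
    all_goals simp
  have h2 : HasDerivAt Real.smoothTransition
      (deriv Real.smoothTransition (z.re ^ 2 + z.im ^ 2 - 1)) (z.re ^ 2 + z.im ^ 2 - 1) :=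
    ((Real.smoothTransition.contDiff (n := 1)).differentiable (by simp) _).hasDerivAt
  have h3 : HasFDerivAt outerWeight _ z := h2.comp_hasFDerivAt z h1
  have h4 : HasFDerivAt (fun z : ℂ => outerWeight z • z) _ z := h3.smul (hasFDerivAt_id z)
  rw [h4.fderiv]
  simp only [outerWeightDeriv, add_apply, smul_apply,
    ContinuousLinearMap.id_apply, ContinuousLinearMap.smulRight_apply, Complex.reCLM_apply,
    Complex.imCLM_apply, smul_eq_mul]
  congr 2
  ring

/-- The weight is constant for |z|² > 2, so the factor |z|² from differentiating it is bounded where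
it matters. This makes the chain rule for weak derivatives applicable. -/
theorem exists_norm_fderiv_outerWeight_smul_le :
    ∃ L : ℝ≥0, ∀ z, ‖fderiv ℝ (fun z : ℂ => outerWeight z • z) z‖ ≤ L := by
  obtain ⟨C, hC⟩ := exists_abs_deriv_smoothTransition_le
  have hC0 : 0 ≤ C := (abs_nonneg _).trans (hC 0)
  refine ⟨⟨1 + 4 * C, by positivity⟩, fun z => ContinuousLinearMap.opNorm_le_bound _
    (NNReal.coe_nonneg _) fun w => ?_⟩
  rw [fderiv_outerWeight_smul]
  have h0 : |outerWeight z| ≤ 1 := by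
    rw [outerWeight, abs_of_nonneg (Real.smoothTransition.nonneg _)]
    exact Real.smoothTransition.le_one _
  have hz : z.re ^ 2 + z.im ^ 2 = ‖z‖ ^ 2 := by
    rw [Complex.sq_norm, Complex.normSq_apply]
    ring
  have hi : |z.re * w.re + z.im * w.im| ≤ ‖z‖ * ‖w‖ := by
    have := Complex.abs_re_le_norm (starRingEnd ℂ z * w)
    rw [norm_mul, Complex.norm_conj] at this
    simpa using this
  have h1 : |outerWeightDeriv z w| * ‖z‖ ≤ 4 * C * ‖w‖ := by
    rw [outerWeightDeriv, hz]
    -- For |z|² > 2 the derivative of the weight is zero; otherwise |z|² ≤ 2 replaces the two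
    -- factors |z| by a constant.
    rcases lt_or_ge 1 (‖z‖ ^ 2 - 1) with h | h
    · rw [deriv_smoothTransition_eq_zero h, zero_mul, abs_zero, zero_mul]
      positivity
    · rw [abs_mul, abs_mul, abs_two]
      calc |deriv Real.smoothTransition (‖z‖ ^ 2 - 1)| * (2 * |z.re * w.re + z.im * w.im|) * ‖z‖
          ≤ C * (2 * (‖z‖ * ‖w‖)) * ‖z‖ := by gcongr; exact hC _
        _ = 2 * C * ‖w‖ * ‖z‖ ^ 2 := by ring
        _ ≤ 2 * C * ‖w‖ * 2 := by gcongr; linarith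
        _ = 4 * C * ‖w‖ := by ring
  calc ‖outerWeight z • w + outerWeightDeriv z w • z‖
      ≤ |outerWeight z| * ‖w‖ + |outerWeightDeriv z w| * ‖z‖ := by
        refine (norm_add_le _ _).trans (le_of_eq ?_)
        rw [norm_smul, norm_smul, Real.norm_eq_abs, Real.norm_eq_abs]
    _ ≤ 1 * ‖w‖ + 4 * C * ‖w‖ := by gcongr
    _ = (1 + 4 * C) * ‖w‖ := by ring

/-- The Euler-Lagrange equation is tested with w(ψ)ψ, where w = `outerWeight` is positive exactly
for |ψ| > 1. Every term of the integrand is then nonnegative: the kinetic term, the term with the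
nonnegative derivative of w, and κ² w |ψ|²(|ψ|² - 1). A vanishing integral forces the last to vanish
almost everywhere. -/
theorem norm_le_one_of_minimizer {D Ω : Set E3} (hΩ : IsOpen Ω) (hb : Bornology.IsBounded Ω)
    {κ H : ℝ} (hκ : κ ≠ 0) {ψ : E3 → ℂ} {A : E3 → E3} (hψ : MemW12 Ω ψ)
    (hP : ∀ j, MemLp (fun x => magneticMomentum Ω (κ * H) A ψ x j) 2 (volume.restrict Ω))
    (h4 : MemLp ψ 4 (volume.restrict Ω))
    (hZ : ∫⁻ x in D, ‖weakCurl D A x - beta‖ₑ ^ 2 ≠ ⊤)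
    (hmin : ∀ φ, MemW12 Ω φ → energyWith D κ H Ω ψ A ≤ energyWith D κ H Ω φ A) :
    ∀ᵐ x ∂(volume.restrict Ω), ‖ψ x‖ ≤ 1 := by
  obtain ⟨L, hL⟩ := exists_norm_fderiv_outerWeight_smul_le
  have hch := fun i => hψ.isWeakPartial_comp hΩ hb contDiff_outerWeight_smul (by simp) hL i
  simp only [fderiv_outerWeight_smul] at hch
  have hgm : AEStronglyMeasurable (fun x => outerWeight (ψ x)) (volume.restrict Ω) :=
    contDiff_outerWeight.continuous.comp_aestronglyMeasurable hψ.1.1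
  have hg1 : ∀ x, ‖outerWeight (ψ x)‖ ≤ 1 := fun x => by
    rw [outerWeight, Real.norm_of_nonneg (Real.smoothTransition.nonneg _)]
    exact Real.smoothTransition.le_one _
  have hq2 : ∀ j, MemLp (fun x => outerWeightDeriv (ψ x) (weakPartial Ω j ψ x) • ψ x) 2
      (volume.restrict Ω) := fun j => by
    have h1 : MemLp (fun x => outerWeight (ψ x) • weakPartial Ω j ψ x) 2 (volume.restrict Ω) :=
      (hψ.memLp_weakPartial hΩ j).of_le_mul (c := 1)
        (hgm.smul (hψ.memLp_weakPartial hΩ j).1) (Eventually.of_forall fun x => by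
          rw [norm_smul]
          exact mul_le_mul_of_nonneg_right (hg1 x) (norm_nonneg _))
    have h2 := (hch j).2.1.sub h1
    refine (memLp_congr_ae (Eventually.of_forall fun x => ?_)).1 h2
    simp
  obtain ⟨hint, h0⟩ := euler_lagrange hΩ hψ hP h4 hZ hmin hgm hg1 (fun j => (hch j).2.2) hq2
  set F : E3 → ℝ := fun x => (∑ j, (starRingEnd ℂ (magneticMomentum Ω (κ * H) A ψ x j)
    * (outerWeight (ψ x) • magneticMomentum Ω (κ * H) A ψ x j
      - Complex.I * (outerWeightDeriv (ψ x) (weakPartial Ω j ψ x) • ψ x))).re)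
    + κ ^ 2 * (outerWeight (ψ x) * ‖ψ x‖ ^ 4) - κ ^ 2 * (outerWeight (ψ x) * ‖ψ x‖ ^ 2) with hF
  have hw0 : ∀ x, 0 ≤ outerWeight (ψ x) := fun x => Real.smoothTransition.nonneg _
  have hnorm : ∀ x, (ψ x).re ^ 2 + (ψ x).im ^ 2 = ‖ψ x‖ ^ 2 := fun x => by
    rw [Complex.sq_norm, Complex.normSq_apply]
    ring
  have hlow : ∀ x, κ ^ 2 * (outerWeight (ψ x) * (‖ψ x‖ ^ 2 * (‖ψ x‖ ^ 2 - 1))) ≤ F x := fun x => by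
    have hs : 0 ≤ ∑ j, (starRingEnd ℂ (magneticMomentum Ω (κ * H) A ψ x j)
        * (outerWeight (ψ x) • magneticMomentum Ω (κ * H) A ψ x j
        - Complex.I * (outerWeightDeriv (ψ x) (weakPartial Ω j ψ x) • ψ x))).re := by
      refine Finset.sum_nonneg fun j _ => ?_
      rw [magneticMomentum_apply, re_conj_mul_variation]
      refine add_nonneg (mul_nonneg (hw0 x) (sq_nonneg _)) ?_
      rw [outerWeightDeriv]
      have := Real.smoothTransition.monotone.deriv_nonneg (x := (ψ x).re ^ 2 + (ψ x).im ^ 2 - 1)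
      -- The derivative of the weight produces a second factor Re(ψ̄ ∂ψ), so this term is a square
      -- times the nonnegative slope of the transition.
      rw [show ∀ a b : ℝ, a * (2 * b) * b = 2 * a * b ^ 2 by intros; ring]
      positivity
    simp only [hF]
    linarith
  have hnn : ∀ x, 0 ≤ κ ^ 2 * (outerWeight (ψ x) * (‖ψ x‖ ^ 2 * (‖ψ x‖ ^ 2 - 1))) := fun x => by
    rcases le_or_gt (‖ψ x‖ ^ 2) 1 with h | h
    · have : outerWeight (ψ x) = 0 := Real.smoothTransition.zero_of_nonpos (by
        rw [hnorm]; linarith)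
      simp [this]
    · have h1 := hw0 x
      have h2 : 0 ≤ ‖ψ x‖ ^ 2 - 1 := by linarith
      positivity
  have hae : F =ᵐ[volume.restrict Ω] 0 :=
    (integral_eq_zero_iff_of_nonneg (fun x => (hnn x).trans (hlow x)) hint).1 h0
  filter_upwards [hae] with x hx
  by_contra hc
  rw [not_le] at hc
  have h1 : 1 < ‖ψ x‖ ^ 2 := by nlinarith
  have h2 : 0 < outerWeight (ψ x) := Real.smoothTransition.pos_of_pos (by
    rw [hnorm]; linarith)
  have h3 := hlow x
  rw [hx, Pi.zero_apply] at h3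
  have h5 : 0 < ‖ψ x‖ ^ 2 - 1 := by linarith
  have h6 : 0 < κ ^ 2 * (outerWeight (ψ x) * (‖ψ x‖ ^ 2 * (‖ψ x‖ ^ 2 - 1))) := by positivity
  linarith

/-! ### The volume of boundary layers -/

/-- The part of a ball in the slab of height `h` above a graph, in the coordinates `T`. -/
def graphSlab (p : E3) (r : ℝ) (T : E3 ≃ₗᵢ[ℝ] E3) (γ : EuclideanSpace ℝ (Fin 2) → ℝ) (h : ℝ) :
    Set E3 :=
  {x ∈ Metric.ball p r | γ (!₂[T x 0, T x 1]) < T x 2 ∧ T x 2 ≤ γ (!₂[T x 0, T x 1]) + h}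

theorem continuous_horizontal (T : E3 ≃ₗᵢ[ℝ] E3) :
    Continuous fun x => (!₂[T x 0, T x 1] : EuclideanSpace ℝ (Fin 2)) := by
  refine (PiLp.continuous_toLp 2 _).comp (continuous_pi fun i => ?_)
  fin_cases i
  · exact (PiLp.continuous_apply 2 _ 0).comp T.continuous
  · exact (PiLp.continuous_apply 2 _ 1).comp T.continuous

theorem measurableSet_graphSlab {p : E3} {r : ℝ} {T : E3 ≃ₗᵢ[ℝ] E3}
    {γ : EuclideanSpace ℝ (Fin 2) → ℝ} (hγ : Continuous γ) (h : ℝ) :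
    MeasurableSet (graphSlab p r T γ h) := by
  have h1 : Continuous fun x => γ (!₂[T x 0, T x 1]) := hγ.comp (continuous_horizontal T)
  have h2 : Continuous fun x => T x 2 := (PiLp.continuous_apply 2 _ 2).comp T.continuous
  exact measurableSet_ball.inter ((isOpen_lt h1 h2).measurableSet.inter
    (isClosed_le h2 (h1.add continuous_const)).measurableSet)

/-- Packing replaces Fubini: vertical translates of the slab by multiples of h are disjoint, and
about 1/h of them fit in the ball of radius r + 1. Only measurability, not the Lipschitz property,
of the graph matters here. -/
theorem volume_graphSlab_le {p : E3} {r : ℝ} {T : E3 ≃ₗᵢ[ℝ] E3}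
    {γ : EuclideanSpace ℝ (Fin 2) → ℝ} (hγ : Continuous γ) {h : ℝ} (hh : 0 < h) :
    volume (graphSlab p r T γ h) ≤ 2 * volume (Metric.ball p (r + 1)) * ENNReal.ofReal h := by
  set S := graphSlab p r T γ h with hS
  set V := volume (Metric.ball p (r + 1)) with hV
  have hSV : volume S ≤ V := measure_mono fun x hx =>
    Metric.ball_subset_ball (by linarith) hx.1
  rcases le_or_gt 1 h with h1 | h1
  · have : (1 : ℝ≥0∞) ≤ ENNReal.ofReal h := ENNReal.one_le_ofReal.2 h1
    calc volume S ≤ 1 * V * 1 := by simpa using hSV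
      _ ≤ 2 * V * ENNReal.ofReal h := by gcongr; norm_num
  set e : E3 := T.symm (EuclideanSpace.single 2 1) with he
  have hTe : ∀ (x : E3) (c : ℝ), T (x + c • e) = T x + c • EuclideanSpace.single 2 1 := fun x c => by
    rw [map_add, map_smul, he, T.apply_symm_apply]
  set n := ⌊1 / h⌋₊ with hn
  let f : ℕ → Set E3 := fun k => (fun x => x + (-(k * h)) • e) ⁻¹' S
  have hfm : ∀ k, MeasurableSet (f k) := fun k =>
    (measurable_id.add_const _) (measurableSet_graphSlab hγ h)
  have hfv : ∀ k, volume (f k) = volume S := fun k => measure_preimage_add_right _ _ _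
  have hfx : ∀ k x, x ∈ f k → γ (!₂[T x 0, T x 1]) < T x 2 - k * h ∧
      T x 2 - k * h ≤ γ (!₂[T x 0, T x 1]) + h := fun k x hx => by
    have h2 := hx.2
    simp only [hTe] at h2
    simpa [sub_eq_add_neg] using h2
  have hdisj : Set.PairwiseDisjoint (Finset.range n : Set ℕ) f := by
    have aux : ∀ k l : ℕ, k < l → Disjoint (f k) (f l) := fun k l hkl => by
      rw [Set.disjoint_left]
      intro x hk hl
      have a := (hfx k x hk).2
      have b := (hfx l x hl).1
      have c : ((k : ℝ) + 1) * h ≤ l * h :=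
        mul_le_mul_of_nonneg_right (by exact_mod_cast hkl) hh.le
      linarith
    intro k _ l _ hkl
    rcases lt_or_gt_of_ne hkl with h | h
    · exact aux k l h
    · exact (aux l k h).symm
  have hsub : (⋃ k ∈ Finset.range n, f k) ⊆ Metric.ball p (r + 1) := by
    intro x hx
    simp only [Set.mem_iUnion, Finset.mem_range] at hx
    obtain ⟨k, hk, hx⟩ := hx
    have hx1 : dist (x + (-(k * h)) • e) p < r := hx.1
    have hkh : (k : ℝ) * h ≤ 1 := by
      have h2 : (k : ℝ) ≤ 1 / h := (Nat.cast_le.2 hk.le).trans (Nat.floor_le (by positivity))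
      rwa [le_div_iff₀ hh] at h2
    have hd : dist x (x + (-(k * h)) • e) ≤ 1 := by
      rw [dist_self_add_right, norm_smul, he, LinearIsometryEquiv.norm_map, PiLp.norm_single,
        norm_one, mul_one, norm_neg, Real.norm_of_nonneg (by positivity)]
      exact hkh
    have := dist_triangle x (x + (-(k * h)) • e) p
    rw [Metric.mem_ball]
    linarith
  have hsum : (n : ℝ≥0∞) * volume S ≤ V := by
    have := measure_mono (μ := volume) hsub
    rw [measure_biUnion_finset hdisj fun k _ => hfm k] at this
    simp only [hfv, Finset.sum_const, Finset.card_range, nsmul_eq_mul] at this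
    exact this
  -- Since h < 1, the floor n of 1/h is at least 1, so 1/h < n + 1 ≤ 2n.
  have hn1 : 1 / h ≤ 2 * n := by
    have h2 : 1 / h < n + 1 := Nat.lt_floor_add_one _
    have h3 : 1 ≤ 1 / h := by rw [le_div_iff₀ hh]; linarith
    have h4 : (1 : ℝ) ≤ n := by exact_mod_cast Nat.le_floor (by simpa using h3)
    linarith
  have hn2 : (1 : ℝ≥0∞) ≤ ENNReal.ofReal h * (2 * n) := by
    have : (1 : ℝ) ≤ h * (2 * n) := by
      rw [div_le_iff₀ hh] at hn1
      linarith
    have h2 := ENNReal.ofReal_le_ofReal this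
    rw [ENNReal.ofReal_one, ENNReal.ofReal_mul hh.le, ENNReal.ofReal_mul zero_le_two,
      ENNReal.ofReal_natCast] at h2
    simpa using h2
  calc volume S = 1 * volume S := (one_mul _).symm
    _ ≤ ENNReal.ofReal h * (2 * n) * volume S := by gcongr
    _ = 2 * (n * volume S) * ENNReal.ofReal h := by ring
    _ ≤ 2 * V * ENNReal.ofReal h := by gcongr

theorem norm_horizontal_le (z : E3) : ‖(!₂[z 0, z 1] : EuclideanSpace ℝ (Fin 2))‖ ≤ ‖z‖ := by
  rw [EuclideanSpace.norm_eq, EuclideanSpace.norm_eq]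
  refine Real.sqrt_le_sqrt ?_
  rw [Fin.sum_univ_two, Fin.sum_univ_three]
  simp only [Matrix.cons_val_zero, Matrix.cons_val_one]
  have := sq_nonneg ‖z 2‖
  linarith

/-- The bound is local in the set of boundary points and subadditive under unions, so compactness of
the boundary reduces it to one chart. Closeness is phrased through a nearby point y, not through a
distance function, in order to split over unions. -/
theorem exists_volume_near_frontier_le {Ω : Set E3} (hΩ : IsBoundedLipschitzDomain Ω) :
    ∃ C : ℝ≥0∞, C ≠ ⊤ ∧ ∃ ε : ℝ, 0 < ε ∧ ∀ t : ℝ, 0 < t → t < ε →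
      volume {x ∈ Ω | ∃ y ∈ frontier Ω, dist x y ≤ t} ≤ C * ENNReal.ofReal t := by
  have hcomp : IsCompact (frontier Ω) :=
    Metric.isCompact_of_isClosed_isBounded isClosed_frontier
      (hΩ.isBounded.closure.subset frontier_subset_closure)
  refine hcomp.induction_on (p := fun s => ∃ C : ℝ≥0∞, C ≠ ⊤ ∧ ∃ ε : ℝ, 0 < ε ∧
    ∀ t : ℝ, 0 < t → t < ε →
      volume {x ∈ Ω | ∃ y ∈ s, dist x y ≤ t} ≤ C * ENNReal.ofReal t) ?_ ?_ ?_ ?_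
  · exact ⟨0, by simp, 1, one_pos, by simp⟩
  · rintro s s' hss ⟨C, hC, ε, hε, h⟩
    refine ⟨C, hC, ε, hε, fun t h0 h1 => (measure_mono ?_).trans (h t h0 h1)⟩
    rintro x ⟨hx, y, hy, hxy⟩
    exact ⟨hx, y, hss hy, hxy⟩
  · rintro s s' ⟨C, hC, ε, hε, h⟩ ⟨C', hC', ε', hε', h'⟩
    refine ⟨C + C', ENNReal.add_ne_top.2 ⟨hC, hC'⟩, min ε ε', lt_min hε hε', fun t h0 h1 => ?_⟩
    rw [add_mul]
    refine (measure_mono ?_).trans ((measure_union_le _ _).trans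
      (add_le_add (h t h0 (h1.trans_le (min_le_left _ _)))
        (h' t h0 (h1.trans_le (min_le_right _ _)))))
    rintro x ⟨hx, y, hy | hy, hxy⟩
    · exact Or.inl ⟨hx, y, hy, hxy⟩
    · exact Or.inr ⟨hx, y, hy, hxy⟩
  · intro p hp
    obtain ⟨T, r, K, γ, hr, hγ, hT⟩ := hΩ.lipschitz p hp
    refine ⟨frontier Ω ∩ Metric.ball p (r / 2), inter_mem_nhdsWithin _
      (Metric.ball_mem_nhds p (half_pos hr)),
      2 * volume (Metric.ball p (r + 1)) * ENNReal.ofReal (1 + K),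
      ENNReal.mul_ne_top (ENNReal.mul_ne_top (by simp) measure_ball_lt_top.ne) (by simp),
      r / 2, half_pos hr, fun t h0 h1 => ?_⟩
    -- A point x of Ω within t of a boundary point y lies above the graph, while y lies on or below
    -- it. Moving from y to x changes the height by at most t and the graph value by at most K t, so
    -- x is in the slab of height (1 + K)t. The radii r/2 keep both points in the chart.
    have hK : (0 : ℝ) < 1 + K := by positivity
    rw [mul_assoc, ← ENNReal.ofReal_mul hK.le]
    refine (measure_mono ?_).trans
      (volume_graphSlab_le (T := T) hγ.continuous (mul_pos hK h0))
    rintro x ⟨hx, y, ⟨hyf, hyp⟩, hxy⟩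
    have hxp : x ∈ Metric.ball p r := by
      have := dist_triangle x y p
      rw [Metric.mem_ball] at hyp ⊢
      linarith
    have hyΩ : y ∉ Ω := fun h => by
      rw [hΩ.isOpen.frontier_eq] at hyf
      exact hyf.2 h
    have hy : T y 2 ≤ γ (!₂[T y 0, T y 1]) := by
      rw [hT y (Metric.ball_subset_ball (by linarith) hyp), not_lt] at hyΩ
      exact hyΩ
    refine ⟨hxp, (hT x hxp).1 hx, ?_⟩
    have hTd : ‖T x - T y‖ ≤ t := by
      rw [← map_sub, T.norm_map, ← dist_eq_norm]
      exact hxy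
    have h2 : T x 2 - T y 2 ≤ t :=
      ((Real.le_norm_self _).trans (PiLp.norm_apply_le (T x - T y) 2)).trans hTd
    have h3 : γ (!₂[T y 0, T y 1]) - γ (!₂[T x 0, T x 1]) ≤ K * t := by
      have a := hγ.dist_le_mul (!₂[T y 0, T y 1]) (!₂[T x 0, T x 1])
      rw [Real.dist_eq] at a
      refine (le_abs_self _).trans (a.trans (mul_le_mul_of_nonneg_left ?_ K.2))
      have e : (!₂[T x 0, T x 1] : EuclideanSpace ℝ (Fin 2)) - !₂[T y 0, T y 1]
          = !₂[(T x - T y) 0, (T x - T y) 1] := by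
        ext i
        fin_cases i <;> simp
      rw [dist_comm, dist_eq_norm, e]
      exact (norm_horizontal_le _).trans hTd
    linarith

theorem frontier_nonempty_of_isBoundedLipschitzDomain {Ω : Set E3}
    (hΩ : IsBoundedLipschitzDomain Ω) : (frontier Ω).Nonempty := by
  rw [nonempty_frontier_iff]
  exact ⟨hΩ.isConnected.nonempty, fun h => NormedSpace.unbounded_univ ℝ E3 (h ▸ hΩ.isBounded)⟩

theorem exists_volume_layer_le {Ω : Set E3} (hΩ : IsBoundedLipschitzDomain Ω) :
    ∃ C : ℝ, 0 < C ∧ ∀ t : ℝ, 0 < t →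
      volume {x ∈ Ω | Metric.infDist x (frontier Ω) ≤ t} ≤ ENNReal.ofReal (C * t) := by
  obtain ⟨C, hC, ε, hε, h⟩ := exists_volume_near_frontier_le hΩ
  have hv : volume Ω ≠ ⊤ := hΩ.isBounded.measure_lt_top.ne
  -- For t ≥ ε the whole volume of Ω is at most (|Ω|/ε) t; the summand 1 only secures positivity.
  refine ⟨C.toReal + (volume Ω).toReal / ε + 1, by positivity, fun t ht => ?_⟩
  rcases lt_or_ge t ε with h1 | h1
  · refine (measure_mono ?_).trans ((h t ht h1).trans ?_)
    · rintro x ⟨hx, hxt⟩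
      obtain ⟨y, hy, hxy⟩ := (Metric.isCompact_of_isClosed_isBounded isClosed_frontier
        (hΩ.isBounded.closure.subset frontier_subset_closure)).exists_infDist_eq_dist
        (frontier_nonempty_of_isBoundedLipschitzDomain hΩ) x
      exact ⟨hx, y, hy, hxy ▸ hxt⟩
    · rw [← ENNReal.ofReal_toReal hC, ← ENNReal.ofReal_mul ENNReal.toReal_nonneg]
      refine ENNReal.ofReal_le_ofReal (mul_le_mul_of_nonneg_right ?_ ht.le)
      rw [ENNReal.toReal_ofReal ENNReal.toReal_nonneg]
      have : 0 ≤ (volume Ω).toReal / ε := by positivity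
      linarith
  · refine (measure_mono fun x hx => hx.1).trans ?_
    rw [← ENNReal.ofReal_toReal hv]
    refine ENNReal.ofReal_le_ofReal ?_
    rw [ENNReal.toReal_ofReal ENNReal.toReal_nonneg]
    have h2 : (volume Ω).toReal ≤ (volume Ω).toReal / ε * t := by
      rw [div_mul_eq_mul_div, le_div_iff₀ hε]
      exact mul_le_mul_of_nonneg_left h1 ENNReal.toReal_nonneg
    refine h2.trans (mul_le_mul_of_nonneg_right ?_ ht.le)
    have := C.toReal_nonneg
    linarith

/-! ### Weak localization of minimizers near the boundary -/

/-- What the estimates use of a minimizer, for either of the functionals: `D` is the domain of the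
magnetic energy. -/
structure IsMinimizingState (D : Set E3) (κ H : ℝ) (Ω : Set E3) (ψ : E3 → ℂ) (A : E3 → E3) :
    Prop where
  subset : Ω ⊆ D
  memW12 : MemW12 Ω ψ
  memLp_potential : ∀ j, MemLp (fun x => A x j) 2 (volume.restrict Ω)
  isWeakPartial : ∀ i j, IsWeakPartial Ω i (fun x => A x j) (weakPartial D i fun x => A x j)
  energy_nonpos : energyWith D κ H Ω ψ A ≤ 0
  energy_le : ∀ φ, MemW12 Ω φ → energyWith D κ H Ω ψ A ≤ energyWith D κ H Ω φ A

namespace IsMinimizingState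

variable {D Ω : Set E3} {κ H : ℝ} {ψ : E3 → ℂ} {A : E3 → E3}

/-- Square integrability of the product Aψ is not evident from A, ψ ∈ L². It is read off from the
finiteness of the energy. -/
theorem memLp_magneticMomentum (hΩ : IsOpen Ω) (h : IsMinimizingState D κ H Ω ψ A) (j : Fin 3) :
    MemLp (fun x => magneticMomentum Ω (κ * H) A ψ x j) 2 (volume.restrict Ω) := by
  have hm : AEStronglyMeasurable (fun x => magneticMomentum Ω (κ * H) A ψ x j)
      (volume.restrict Ω) := by
    simp only [magneticMomentum_apply]
    have h1 := ((h.memLp_potential j).1.const_mul (κ * H))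
    have h2 : AEStronglyMeasurable (fun x => ((κ * H * A x j : ℝ) : ℂ)) (volume.restrict Ω) :=
      Complex.continuous_ofReal.comp_aestronglyMeasurable h1
    exact ((h.memW12.memLp_weakPartial hΩ j).1.const_mul _).add (h2.mul h.memW12.1.1)
  refine memLp_two_of_lintegral_lt_top hm ?_
  refine lt_of_le_of_lt (lintegral_mono fun x => ?_)
    ((le_self_add.trans (le_self_add.trans
      (lintegral_add_le_of_energyWith_nonpos h.energy_nonpos))).trans_lt ENNReal.ofReal_lt_top)
  refine pow_le_pow_left' ?_ 2
  rw [← ofReal_norm, ← ofReal_norm]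
  exact ENNReal.ofReal_le_ofReal (PiLp.norm_apply_le _ j)

theorem memLp_four (h : IsMinimizingState D κ H Ω ψ A) (hκ : κ ≠ 0) :
    MemLp ψ 4 (volume.restrict Ω) := by
  refine ⟨h.memW12.1.1, ?_⟩
  have h1 : ENNReal.ofReal (κ ^ 2 / 2) * (∫⁻ x in Ω, ‖ψ x‖ₑ ^ 4) < ⊤ :=
    (le_add_self.trans (le_self_add.trans
      (lintegral_add_le_of_energyWith_nonpos h.energy_nonpos))).trans_lt ENNReal.ofReal_lt_top
  have h2 : ∫⁻ x in Ω, ‖ψ x‖ₑ ^ 4 < ⊤ := by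
    refine lt_of_mul_lt_mul_left' (a := ENNReal.ofReal (κ ^ 2 / 2)) ?_
    rwa [ENNReal.mul_top (by simpa using by positivity)]
  rw [eLpNorm_lt_top_iff_lintegral_rpow_enorm_lt_top (by norm_num) (by norm_num)]
  simpa only [ENNReal.toReal_ofNat, ENNReal.rpow_ofNat] using h2

theorem lintegral_curl_ne_top (h : IsMinimizingState D κ H Ω ψ A) (hκH : 0 < κ * H) :
    ∫⁻ x in D, ‖weakCurl D A x - beta‖ₑ ^ 2 ≠ ⊤ := by
  have h1 : ENNReal.ofReal (κ ^ 2 * H ^ 2) * (∫⁻ x in D, ‖weakCurl D A x - beta‖ₑ ^ 2) < ⊤ :=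
    (le_add_self.trans
      (lintegral_add_le_of_energyWith_nonpos h.energy_nonpos)).trans_lt ENNReal.ofReal_lt_top
  refine (lt_of_mul_lt_mul_left' (a := ENNReal.ofReal (κ ^ 2 * H ^ 2)) ?_).ne
  rwa [ENNReal.mul_top]
  rw [← mul_pow]
  exact (ENNReal.ofReal_pos.2 (by positivity)).ne'

theorem norm_le_one (hΩ : IsOpen Ω) (hb : Bornology.IsBounded Ω)
    (h : IsMinimizingState D κ H Ω ψ A) (hκH : 0 < κ * H) :
    ∀ᵐ x ∂(volume.restrict Ω), ‖ψ x‖ ≤ 1 :=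
  norm_le_one_of_minimizer hΩ hb (left_ne_zero_of_mul hκH.ne') h.memW12
    (h.memLp_magneticMomentum hΩ) (h.memLp_four (left_ne_zero_of_mul hκH.ne'))
    (h.lintegral_curl_ne_top hκH) h.energy_le

/-- Nonpositive energy bounds κ²H² ∫_D |curl A - β|² by κ² ∫_Ω |ψ|². Only the third component on Ω
is kept, and κ² cancels. -/
theorem magnetic_energy_le (h : IsMinimizingState D κ H Ω ψ A) (hκH : 0 < κ * H) :
    MemLp (fun x => weakPartial D 0 (fun y => A y 1) x - weakPartial D 1 (fun y => A y 0) x - 1) 2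
      (volume.restrict Ω) ∧
    H ^ 2 * ∫ x in Ω, (weakPartial D 0 (fun y => A y 1) x
      - weakPartial D 1 (fun y => A y 0) x - 1) ^ 2 ≤ ∫ x in Ω, ‖ψ x‖ ^ 2 := by
  set c : E3 → ℝ := fun x => weakPartial D 0 (fun y => A y 1) x
    - weakPartial D 1 (fun y => A y 0) x - 1 with hc
  have hκ := left_ne_zero_of_mul hκH.ne'
  have hZ := h.lintegral_curl_ne_top hκH
  set Z := ∫⁻ x in D, ‖weakCurl D A x - beta‖ₑ ^ 2 with hZdef
  have hcm : AEStronglyMeasurable c (volume.restrict Ω) :=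
    ((h.isWeakPartial 0 1).2.1.aestronglyMeasurable.sub
      (h.isWeakPartial 1 0).2.1.aestronglyMeasurable).sub aestronglyMeasurable_const
  have hcx : ∀ x, ‖c x‖ ≤ ‖weakCurl D A x - beta‖ := fun x => by
    have := PiLp.norm_apply_le (weakCurl D A x - beta) 2
    simpa [weakCurl, beta] using this
  have hcZ : ∫⁻ x in Ω, ‖c x‖ₑ ^ 2 ≤ Z := by
    refine (lintegral_mono fun x => ?_).trans (lintegral_mono_set h.subset)
    refine pow_le_pow_left' ?_ 2
    rw [← ofReal_norm, ← ofReal_norm]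
    exact ENNReal.ofReal_le_ofReal (hcx x)
  have hc2 : MemLp c 2 (volume.restrict Ω) :=
    memLp_two_of_lintegral_lt_top hcm (hcZ.trans_lt hZ.lt_top)
  refine ⟨hc2, ?_⟩
  have e : ∫⁻ x in Ω, ‖c x‖ₑ ^ 2 = ENNReal.ofReal (∫ x in Ω, c x ^ 2) :=
    lintegral_ofReal_of_integrable hc2.integrable_sq (fun x => sq_nonneg _) fun x => by
      rw [enorm_pow_eq_ofReal, Real.norm_eq_abs, sq_abs]
  have h1 : ENNReal.ofReal (κ ^ 2 * H ^ 2) * ENNReal.ofReal (∫ x in Ω, c x ^ 2)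
      ≤ ENNReal.ofReal (κ ^ 2 * ∫ x in Ω, ‖ψ x‖ ^ 2) := by
    rw [← e]
    exact (mul_le_mul_right hcZ _).trans (le_add_self.trans
      (lintegral_add_le_of_energyWith_nonpos h.energy_nonpos))
  rw [← ENNReal.ofReal_mul (by positivity), ENNReal.ofReal_le_ofReal_iff
    (mul_nonneg (sq_nonneg _) (integral_nonneg fun x => by positivity)), mul_assoc] at h1
  exact le_of_mul_le_mul_left h1 (by positivity)

end IsMinimizingState

/-- The localization formula: with η = ∂χ, the cross term is the one produced by testing the
Euler-Lagrange equation with χ²ψ, so the two differ only by |∂χ|²|ψ|². -/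
theorem norm_sq_cutoff_momentum (d z : ℂ) (b χ η : ℝ) :
    ‖-Complex.I * (χ • d + η • z) + (b : ℂ) * (χ • z)‖ ^ 2
      = χ * χ * ‖-Complex.I * d + (b : ℂ) * z‖ ^ 2
        + (χ * η + χ * η) * (z.re * d.re + z.im * d.im) + η ^ 2 * ‖z‖ ^ 2 := by
  simp only [Complex.sq_norm, Complex.normSq_apply, Complex.add_re, Complex.add_im,
    Complex.real_smul, Complex.mul_re, Complex.mul_im, Complex.ofReal_re, Complex.ofReal_im,
    Complex.neg_re, Complex.neg_im, Complex.I_re, Complex.I_im]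
  ring

/-- The magnetic energy of `χ ψ`, computed with the Euler-Lagrange equation. -/
theorem IsMinimizingState.cutoff_estimate {D Ω : Set E3} (hΩ : IsOpen Ω)
    (hb : Bornology.IsBounded Ω) {κ H : ℝ} {ψ : E3 → ℂ} {A : E3 → E3}
    (h : IsMinimizingState D κ H Ω ψ A) (hκH : 0 < κ * H) {χ : E3 → ℝ}
    (hχ : IsTestFunction Ω χ) (hχ0 : ∀ x, 0 ≤ χ x) (hχ1 : ∀ x, χ x ≤ 1) :
    κ * (H - κ) * ∫ x in Ω, χ x ^ 2 * ‖ψ x‖ ^ 2 ≤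
      (∫ x in Ω, (∑ j, partialDeriv j χ x ^ 2) * ‖ψ x‖ ^ 2) + (∫ x in Ω, ‖ψ x‖ ^ 2) / 4 := by
  have hκ := left_ne_zero_of_mul hκH.ne'
  have hP := h.memLp_magneticMomentum hΩ
  have h4 := h.memLp_four hκ
  have hψ := h.memW12
  obtain ⟨hc2, hcle⟩ := h.magnetic_energy_le hκH
  have hone := h.norm_le_one hΩ hb hκH
  set c : E3 → ℝ := fun x => weakPartial D 0 (fun y => A y 1) x
    - weakPartial D 1 (fun y => A y 0) x - 1 with hc
  have hvol : volume Ω ≠ ⊤ := hb.measure_lt_top.ne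
  have : IsFiniteMeasure (volume.restrict Ω) := ⟨by simpa using hvol.lt_top⟩
  have hχn : ∀ x, ‖χ x‖ ≤ 1 := fun x => by
    rw [Real.norm_of_nonneg (hχ0 x)]
    exact hχ1 x
  have hχχ : ContDiff ℝ ∞ fun x => χ x * χ x := hχ.1.mul hχ.1
  have hbd : ∀ᵐ x, ‖χ x • ψ x‖ ≤ 1 := by
    rw [ae_restrict_iff' hΩ.measurableSet] at hone
    filter_upwards [hone] with x hx
    by_cases hxΩ : x ∈ Ω
    · rw [norm_smul]
      exact mul_le_one₀ (hχn x) (norm_nonneg _) (hx hxΩ)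
    · simp [hχ.eq_zero hxΩ]
  have hdint : IntegrableOn (fun x => weakPartial D 0 (fun y => A y 1) x
      - weakPartial D 1 (fun y => A y 0) x) Ω := by
    have := (hc2.integrable (by norm_num)).add (integrable_const (1 : ℝ))
    refine this.congr (Eventually.of_forall fun x => ?_)
    simp [hc]
  have hmag := magnetic_lower_bound hΩ (h.isWeakPartial 1 0) (h.isWeakPartial 0 1)
    (h.memLp_potential 0) (h.memLp_potential 1) hdint (κ * H) hψ hχ hbd
  obtain ⟨hELi, hEL⟩ := euler_lagrange (g := fun x => χ x * χ x) (M := 1)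
    (q := fun j x => (χ x * partialDeriv j χ x + χ x * partialDeriv j χ x) • ψ x) hΩ hψ hP h4
    (h.lintegral_curl_ne_top hκH) h.energy_le hχχ.continuous.aestronglyMeasurable
    (fun x => by
      rw [norm_mul]
      exact mul_le_one₀ (hχn x) (norm_nonneg _) (hχn x))
    (fun j => by
      have := (hψ.isWeakPartial j).smul_contDiff hΩ hχχ
      simpa only [partialDeriv_mul hχ.1 hχ.1] using this)
    (fun j => by
      have h1 := hχ.mul_right (contDiff_partialDeriv (i := j) hχ.1)
      have h2 := (h1.memLp_smul hΩ.measurableSet hψ.1).restrict Ω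
      simp only [add_smul]
      exact h2.add h2)
  simp only [magneticMomentum_apply, re_conj_mul_variation] at hEL hELi
  set R : Fin 3 → E3 → ℝ := fun j x =>
    ‖-Complex.I * (χ x • weakPartial Ω j ψ x + partialDeriv j χ x • ψ x)
      + ((κ * H * A x j : ℝ) : ℂ) * (χ x • ψ x)‖ ^ 2 with hR
  have iR : ∀ j, Integrable (R j) (volume.restrict Ω) := fun j => by
    have h1 := (hχ.memLp_smul hΩ.measurableSet (hP j)).restrict Ω
    have h2 := (((hχ.partialDeriv j).memLp_smul hΩ.measurableSet hψ.1).restrict Ω).const_mul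
      (-Complex.I)
    refine (h1.add h2).norm.integrable_sq.congr (Eventually.of_forall fun x => ?_)
    simp only [hR, Pi.add_apply, magneticMomentum_apply]
    congr 2
    simp only [Complex.real_smul]
    ring
  have i2 := hψ.1.norm.integrable_sq
  have i4 := MemLp.integrable_norm_four h4
  have ic := hc2.integrable_sq
  have bI : ∀ {w f : E3 → ℝ}, IsTestFunction Ω w → Integrable f (volume.restrict Ω) →
      Integrable (fun x => w x * f x) (volume.restrict Ω) := fun {w f} hw hf => by
    obtain ⟨M, hM⟩ := hw.2.1.exists_bound_of_continuous hw.1.continuous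
    exact hf.bdd_mul hw.1.continuous.aestronglyMeasurable (Eventually.of_forall hM)
  have tχχ := hχ.mul_right hχ.1
  have j2 := bI tχχ i2
  have j4 := bI tχχ i4
  have jd : Integrable (fun x => (∑ j, partialDeriv j χ x ^ 2) * ‖ψ x‖ ^ 2)
      (volume.restrict Ω) := by
    have h1 : ∀ j, Integrable (fun x => partialDeriv j χ x ^ 2 * ‖ψ x‖ ^ 2)
        (volume.restrict Ω) := fun j => by
      simpa only [sq (partialDeriv j χ _)] using
        bI ((hχ.partialDeriv j).mul_right (hχ.partialDeriv j).1) i2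
    simpa only [Finset.sum_mul] using integrable_finsetSum Finset.univ fun j _ => h1 j
  set F : E3 → ℝ := fun x => (∑ j, (χ x * χ x * ‖-Complex.I * weakPartial Ω j ψ x
      + ((κ * H * A x j : ℝ) : ℂ) * ψ x‖ ^ 2
      + (χ x * partialDeriv j χ x + χ x * partialDeriv j χ x)
        * ((ψ x).re * (weakPartial Ω j ψ x).re + (ψ x).im * (weakPartial Ω j ψ x).im)))
      + κ ^ 2 * (χ x * χ x * ‖ψ x‖ ^ 4) - κ ^ 2 * (χ x * χ x * ‖ψ x‖ ^ 2) with hF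
  set G : E3 → ℝ := fun x => F x - κ ^ 2 * (χ x * χ x * ‖ψ x‖ ^ 4)
    + κ ^ 2 * (χ x * χ x * ‖ψ x‖ ^ 2) + (∑ j, partialDeriv j χ x ^ 2) * ‖ψ x‖ ^ 2 with hG
  have iF : Integrable F (volume.restrict Ω) := hELi
  have iG1 : Integrable (fun x => F x - κ ^ 2 * (χ x * χ x * ‖ψ x‖ ^ 4))
      (volume.restrict Ω) := iF.sub (j4.const_mul _)
  have iG2 : Integrable (fun x => F x - κ ^ 2 * (χ x * χ x * ‖ψ x‖ ^ 4)
      + κ ^ 2 * (χ x * χ x * ‖ψ x‖ ^ 2)) (volume.restrict Ω) := iG1.add (j2.const_mul _)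
  have iG : Integrable G (volume.restrict Ω) := iG2.add jd
  have eG : ∫ x in Ω, G x = - (κ ^ 2 * ∫ x in Ω, χ x * χ x * ‖ψ x‖ ^ 4)
      + κ ^ 2 * (∫ x in Ω, χ x * χ x * ‖ψ x‖ ^ 2)
      + ∫ x in Ω, (∑ j, partialDeriv j χ x ^ 2) * ‖ψ x‖ ^ 2 := by
    have e0 : ∫ x in Ω, F x = 0 := hEL
    rw [hG, integral_add iG2 jd, integral_add iG1 (j2.const_mul _),
      integral_sub iF (j4.const_mul _), e0, integral_const_mul, integral_const_mul]
    ring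
  have hRG : (∫ x in Ω, R 0 x) + ∫ x in Ω, R 1 x ≤ ∫ x in Ω, G x := by
    rw [← integral_add (iR 0) (iR 1)]
    refine integral_mono ((iR 0).add (iR 1)) iG fun x => ?_
    -- The magnetic bound uses only the two components orthogonal to β; the third is discarded.
    have h0 : 0 ≤ R 2 x := sq_nonneg _
    have h1 : G x = R 0 x + R 1 x + R 2 x := by
      simp only [hG, hF, hR, norm_sq_cutoff_momentum, Fin.sum_univ_three]
      ring
    simp only [h1]
    linarith
  have hlow : κ * H * (∫ x in Ω, χ x * χ x * ‖ψ x‖ ^ 2)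
      - κ ^ 2 * (∫ x in Ω, χ x * χ x * ‖ψ x‖ ^ 4) - H ^ 2 / 4 * (∫ x in Ω, c x ^ 2)
      ≤ κ * H * ∫ x in Ω, (weakPartial D 0 (fun y => A y 1) x
        - weakPartial D 1 (fun y => A y 0) x) * ‖χ x • ψ x‖ ^ 2 := by
    have k1 : Integrable (fun x => κ * H * (χ x * χ x * ‖ψ x‖ ^ 2)
        - κ ^ 2 * (χ x * χ x * ‖ψ x‖ ^ 4)) (volume.restrict Ω) :=
      (j2.const_mul _).sub (j4.const_mul _)
    rw [← integral_const_mul, ← integral_const_mul, ← integral_const_mul, ← integral_const_mul,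
      ← integral_sub (j2.const_mul _) (j4.const_mul _), ← integral_sub k1 (ic.const_mul _)]
    refine integral_mono_ae (k1.sub (ic.const_mul _)) ?_ (Eventually.of_forall fun x => ?_)
    · refine Integrable.const_mul (Integrable.mul_bdd (c := 1) hdint ?_ ?_) _
      · exact ((hχ.memLp_smul hΩ.measurableSet hψ.1).1.restrict.norm.pow 2)
      · filter_upwards [ae_restrict_of_ae hbd] with x hx
        rw [norm_pow, norm_norm]
        exact pow_le_one₀ (norm_nonneg _) hx
    · have hd : weakPartial D 0 (fun y => A y 1) x - weakPartial D 1 (fun y => A y 0) x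
          = 1 + c x := by
        simp [hc]
      simp only [hd]
      rw [norm_smul, Real.norm_of_nonneg (hχ0 x)]
      have h1 : χ x * χ x ≤ 1 := mul_le_one₀ (hχ1 x) (hχ0 x) (hχ1 x)
      have h2 : 0 ≤ χ x * χ x := mul_self_nonneg _
      have h3 : 0 ≤ ‖ψ x‖ ^ 4 := by positivity
      have h5 : (χ x * χ x) * (χ x * χ x) * ‖ψ x‖ ^ 4 ≤ (χ x * χ x) * ‖ψ x‖ ^ 4 := by
        refine mul_le_mul_of_nonneg_right ?_ h3
        exact mul_le_of_le_one_left h2 h1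
      have h6 : 0 ≤ κ ^ 2 * ((χ x * χ x) * ‖ψ x‖ ^ 4 - (χ x * χ x) * (χ x * χ x) * ‖ψ x‖ ^ 4) :=
        mul_nonneg (sq_nonneg _) (by linarith)
      -- Completing the square bounds the field error κH c χ²|ψ|² below by -κ²χ⁴|ψ|⁴ - H²c²/4; `h6`
      -- then replaces χ⁴ by χ². The weights are chosen to match the quartic term of the
      -- Euler-Lagrange equation and the bound on H² ∫ c².
      have h7 := sq_nonneg (κ * (χ x * χ x * ‖ψ x‖ ^ 2) + H * c x / 2)
      nlinarith
  have hsq : ∫ x in Ω, χ x ^ 2 * ‖ψ x‖ ^ 2 = ∫ x in Ω, χ x * χ x * ‖ψ x‖ ^ 2 := by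
    simp only [sq (χ _)]
  rw [hsq]
  have hfin := (hlow.trans hmag).trans hRG
  rw [eG] at hfin
  linarith

/-- Half of the mass of `ψ` lies in the boundary layer, up to a constant. -/
theorem IsMinimizingState.integral_le_boundaryLayer {D Ω : Set E3} (hΩ : IsOpen Ω)
    (hb : Bornology.IsBounded Ω) {κ H : ℝ} {ψ : E3 → ℂ} {A : E3 → E3}
    (h : IsMinimizingState D κ H Ω ψ A) (hs : 1 / 2 ≤ κ * (H - κ)) :
    ∫ x in Ω, ‖ψ x‖ ^ 2 ≤ 98 * ∫ x in boundaryLayer Ω (κ * (H - κ)), ‖ψ x‖ ^ 2 := by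
  have hκH : 0 < κ * H := by nlinarith [sq_nonneg κ]
  set s := κ * (H - κ) with hsdef
  have hs0 : 0 < s := by linarith
  have hrs : 0 < √s := Real.sqrt_pos.2 hs0
  obtain ⟨χ, hχ, hχ0, hχ1, hχd, hχin, hχdin⟩ := exists_cutoff hb (one_div_pos.2 hrs)
  have hmain := h.cutoff_estimate hΩ hb hκH hχ hχ0 hχ1
  rw [← hsdef] at hmain
  have i2 : IntegrableOn (fun x => ‖ψ x‖ ^ 2) Ω := h.memW12.1.norm.integrable_sq
  set Λ := boundaryLayer Ω s with hΛ
  have hΛm : MeasurableSet Λ := hΩ.measurableSet.inter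
    (isClosed_le (continuous_const.mul (Metric.continuous_infDist_pt _))
      continuous_const).measurableSet
  have hΛΩ : Λ ⊆ Ω := fun x hx => hx.1
  have hout : ∀ x ∈ Ω, x ∉ Λ → 1 / √s < Metric.infDist x Ωᶜ := fun x hx hxΛ => by
    have h1 : 1 < √s * Metric.infDist x (frontier Ω) := by
      by_contra hc
      exact hxΛ ⟨hx, not_lt.1 hc⟩
    -- The cutoff is built from the distance to the complement, the layer from the distance to the
    -- boundary. A nearest point of the complement lies on the boundary.
    obtain ⟨y, hy, hxy⟩ := exists_mem_frontier_infDist_compl_eq_dist hx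
      fun he => NormedSpace.unbounded_univ ℝ E3 (he ▸ hb)
    rw [hxy, div_lt_iff₀ hrs, mul_comm]
    exact h1.trans_le (mul_le_mul_of_nonneg_left (Metric.infDist_le_dist_of_mem hy) hrs.le)
  have eΛ : ∫ x in Ω, Λ.indicator (fun x => ‖ψ x‖ ^ 2) x = ∫ x in Λ, ‖ψ x‖ ^ 2 := by
    rw [setIntegral_indicator hΛm, Set.inter_eq_right.2 hΛΩ]
  have iΛ : IntegrableOn (Λ.indicator fun x => ‖ψ x‖ ^ 2) Ω := i2.indicator hΛm
  have iχ : IntegrableOn (fun x => χ x ^ 2 * ‖ψ x‖ ^ 2) Ω :=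
    Integrable.bdd_mul (c := 1) i2 (hχ.1.continuous.pow 2).aestronglyMeasurable
      (Eventually.of_forall fun x => by
        rw [Real.norm_of_nonneg (sq_nonneg _)]
        exact pow_le_one₀ (hχ0 x) (hχ1 x))
  have hgrad : ∫ x in Ω, (∑ j, partialDeriv j χ x ^ 2) * ‖ψ x‖ ^ 2
      ≤ 48 * s * ∫ x in Λ, ‖ψ x‖ ^ 2 := by
    rw [← eΛ, ← integral_const_mul]
    refine integral_mono_of_nonneg (Eventually.of_forall fun x => by positivity)
      (iΛ.const_mul _) ?_
    filter_upwards [ae_restrict_mem hΩ.measurableSet] with x hx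
    by_cases hxΛ : x ∈ Λ
    · simp only [Set.indicator_of_mem hxΛ]
      refine mul_le_mul_of_nonneg_right ?_ (sq_nonneg _)
      have hj : ∀ j, partialDeriv j χ x ^ 2 ≤ 16 * s := fun j => by
        have h1 := hχd j x
        rw [one_div, div_inv_eq_mul] at h1
        calc partialDeriv j χ x ^ 2 = |partialDeriv j χ x| ^ 2 := (sq_abs _).symm
          _ ≤ (4 * √s) ^ 2 := by gcongr
          _ = 16 * s := by rw [mul_pow, Real.sq_sqrt hs0.le]; norm_num
      rw [Fin.sum_univ_three]
      linarith [hj 0, hj 1, hj 2]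
    · simp [Set.indicator_of_notMem hxΛ, hχdin _ x (hout x hx hxΛ)]
  have hsplit : ∫ x in Ω, ‖ψ x‖ ^ 2
      ≤ (∫ x in Ω, χ x ^ 2 * ‖ψ x‖ ^ 2) + ∫ x in Λ, ‖ψ x‖ ^ 2 := by
    rw [← eΛ, ← integral_add iχ iΛ]
    refine integral_mono_ae i2 (iχ.add iΛ) ?_
    filter_upwards [ae_restrict_mem hΩ.measurableSet] with x hx
    by_cases hxΛ : x ∈ Λ
    · simp only [Set.indicator_of_mem hxΛ]
      have : 0 ≤ χ x ^ 2 * ‖ψ x‖ ^ 2 := by positivity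
      linarith
    · simp [Set.indicator_of_notMem hxΛ, hχin x (hout x hx hxΛ).le]
  set a := ∫ x in Ω, χ x ^ 2 * ‖ψ x‖ ^ 2
  set b := ∫ x in Λ, ‖ψ x‖ ^ 2
  have hb0 : 0 ≤ b := integral_nonneg fun x => by positivity
  have ha0 : 0 ≤ a := integral_nonneg fun x => by positivity
  -- From s a ≤ 48 s b + (a + b)/4 and 1/4 ≤ s/2 one gets s a/2 ≤ (48 + 1/2) s b. The number 48 is
  -- three components times 4².
  have h1 : s * a ≤ s * (97 * b) := by nlinarith
  have h2 := le_of_mul_le_mul_left h1 hs0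
  linarith

/-! ### The potential of the constant field and states of zero energy -/

/-- The `j`-th component of `potentialF` as a continuous linear form. -/
def potentialFForm (j : Fin 3) : E3 →L[ℝ] ℝ :=
  ![(-1 / 2 : ℝ) • EuclideanSpace.proj 1, (1 / 2 : ℝ) • EuclideanSpace.proj 0, 0] j

theorem potentialF_apply (x : E3) (j : Fin 3) : potentialF x j = potentialFForm j x := by
  fin_cases j
  all_goals simp [potentialF, potentialFForm]
  all_goals ring

theorem isWeakPartial_potentialF (U : Set E3) (i j : Fin 3) :
    IsWeakPartial U i (fun x => potentialF x j)
      (fun _ => potentialFForm j (EuclideanSpace.single i 1)) := by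
  simp only [potentialF_apply]
  have := isWeakPartial_of_contDiff (U := U) (i := i) (potentialFForm j).contDiff
  simpa only [ContinuousLinearMap.fderiv] using this

theorem weakCurl_potentialF {U : Set E3} (hU : IsOpen U) :
    weakCurl U potentialF =ᵐ[volume.restrict U] fun _ => beta := by
  have h := fun i j => weakPartial_ae_eq hU (isWeakPartial_potentialF U i j)
  filter_upwards [h 1 2, h 2 1, h 2 0, h 0 2, h 0 1, h 1 0] with x h1 h2 h3 h4 h5 h6
  rw [weakCurl, h1, h2, h3, h4, h5, h6, beta]
  simp only [potentialFForm]
  ext k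
  fin_cases k
  all_goals simp
  norm_num

theorem memLp_potentialF {Ω : Set E3} (hΩ : IsOpen Ω) (hb : Bornology.IsBounded Ω) (j : Fin 3) :
    MemLp (fun x => potentialF x j) 2 (volume.restrict Ω) := by
  have : IsFiniteMeasure (volume.restrict Ω) := ⟨by simpa using hb.measure_lt_top⟩
  obtain ⟨M, hM⟩ := hb.exists_norm_le
  simp only [potentialF_apply]
  refine MemLp.of_bound (potentialFForm j).continuous.aestronglyMeasurable
    (‖potentialFForm j‖ * M) ?_
  filter_upwards [ae_restrict_mem hΩ.measurableSet] with x hx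
  exact ((potentialFForm j).le_opNorm x).trans
    (mul_le_mul_of_nonneg_left (hM x hx) (norm_nonneg _))

theorem memW12Vec_potentialF {Ω : Set E3} (hΩ : IsOpen Ω) (hb : Bornology.IsBounded Ω) :
    MemW12Vec Ω potentialF := by
  have : IsFiniteMeasure (volume.restrict Ω) := ⟨by simpa using hb.measure_lt_top⟩
  exact fun j => ⟨memLp_potentialF hΩ hb j, fun i =>
    ⟨_, isWeakPartial_potentialF Ω i j, memLp_const _⟩⟩

theorem memHomH1Div_zero : MemHomH1Div fun _ => 0 := by
  refine ⟨fun j => ⟨MemLp.zero', fun _ _ => 0, fun n => ⟨contDiff_const, HasCompactSupport.zero,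
    Set.subset_univ _⟩, ?_, fun i => ⟨0, MemLp.zero', ?_⟩⟩, ?_⟩
  · have e : ((fun _ => (0 : ℝ)) - fun _ => (0 : E3) j : E3 → ℝ) = 0 := by
      funext x
      simp
    exact tendsto_const_nhds.congr fun n => by rw [e, eLpNorm_zero]
  · have e : (partialDeriv i (fun _ => (0 : ℝ)) - 0 : E3 → ℝ) = 0 := by
      funext x
      simp [partialDeriv]
    simp [e]
  · have h := fun i => weakPartial_ae_eq (V := ℝ) isOpen_univ
      (isWeakPartial_zero (U := Set.univ) (i := i))
    simp only [Measure.restrict_univ] at h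
    filter_upwards [h 0, h 1, h 2] with x h0 h1 h2
    simp only [weakDiv, Fin.sum_univ_three, PiLp.zero_apply, h0, h1, h2]
    simp

theorem memW12_zero {V : Type*} [NormedAddCommGroup V] [NormedSpace ℝ V] (U : Set E3) :
    MemW12 U fun _ => (0 : V) :=
  ⟨MemLp.zero', fun _ => ⟨_, isWeakPartial_zero, MemLp.zero'⟩⟩

/-- The normal state, used as the competitor that makes the minimal energy nonpositive. -/
theorem energyWith_zero {D Ω : Set E3} (hΩ : IsOpen Ω) (κ H : ℝ) {A : E3 → E3}
    (hA : weakCurl D A =ᵐ[volume.restrict D] fun _ => beta) :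
    energyWith D κ H Ω (fun _ => 0) A = 0 := by
  have h := fun i => weakPartial_ae_eq (V := ℂ) hΩ (isWeakPartial_zero (U := Ω) (i := i))
  have e1 : ∫⁻ x in Ω, ‖magneticMomentum Ω (κ * H) A (fun _ => 0) x‖ₑ ^ 2 = 0 := by
    rw [← lintegral_zero (μ := volume.restrict Ω)]
    refine lintegral_congr_ae ?_
    filter_upwards [h 0, h 1, h 2] with x h0 h1 h2
    have : magneticMomentum Ω (κ * H) A (fun _ => 0) x = 0 := by
      ext j
      rw [magneticMomentum_apply]
      fin_cases j
      · simp [h0]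
      · simp [h1]
      · simp [h2]
    simp [this]
  have e2 : ∫⁻ x in D, ‖weakCurl D A x - beta‖ₑ ^ 2 = 0 := by
    rw [← lintegral_zero (μ := volume.restrict D)]
    refine lintegral_congr_ae ?_
    filter_upwards [hA] with x hx
    simp [hx]
  rw [energyWith, e1, e2]
  simp

/-! ### Minimizers of the functionals -/

/-- The integration by parts formula survives the limit, with the functions converging in L⁶ and
their derivatives in L². It guarantees that `weakPartial` is a genuine derivative and not its
default value 0. -/
theorem MemHomH1.exists_isWeakPartial {f : E3 → ℝ} (hf : MemHomH1 f) (i : Fin 3) :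
    ∃ g, IsWeakPartial Set.univ i f g := by
  obtain ⟨hf6, φ, hφ, hφf, hd⟩ := hf
  obtain ⟨g, hg2, hg⟩ := hd i
  have hfl : LocallyIntegrable f := hf6.locallyIntegrable (by norm_num)
  have hgl : LocallyIntegrable g := hg2.locallyIntegrable (by norm_num)
  refine ⟨g, isWeakPartial_of_integral_eq (hfl.locallyIntegrableOn _)
    (hgl.locallyIntegrableOn _) fun θ hθ => ?_⟩
  have lim2 : Tendsto (fun n => ∫ x, θ x • partialDeriv i (φ n) x) atTop
      (𝓝 (∫ x, θ x • g x)) :=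
    tendsto_integral_smul_of_eLpNorm_two hθ.memLp (fun n => ((hφ n).partialDeriv i).memLp) hg2 hg
  have hm : ∀ n, MemLp (φ n) 6 volume := fun n =>
    (hφ n).1.continuous.memLp_of_hasCompactSupport (hφ n).2.1
  have hθd : MemLp (partialDeriv i θ) (6 / 5 : ℝ≥0∞) volume :=
    (hθ.partialDeriv i).1.continuous.memLp_of_hasCompactSupport (hθ.partialDeriv i).2.1
  -- L⁶ convergence is paired with test functions in the dual exponent: 5/6 + 1/6 = 1.
  have htr : ENNReal.HolderTriple (6 / 5) 6 1 := ⟨by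
    rw [ENNReal.inv_div (by simp) (by simp), inv_one, ← one_div (6 : ℝ≥0∞),
      ENNReal.div_add_div_same]
    norm_num
    exact ENNReal.div_self (by simp) (by simp)⟩
  have hi : ∀ {w : E3 → ℝ}, MemLp w 6 volume → Integrable (fun x => partialDeriv i θ x • w x) :=
    fun hw => memLp_one_iff_integrable.1 (hw.smul hθd)
  have lim1 : Tendsto (fun n => ∫ x, partialDeriv i θ x • φ n x) atTop
      (𝓝 (∫ x, partialDeriv i θ x • f x)) := by
    refine tendsto_integral_of_L1' _ (hi hf6).1 (Eventually.of_forall fun n => hi (hm n)) ?_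
    have hle : ∀ n, eLpNorm ((fun x => partialDeriv i θ x • φ n x)
        - fun x => partialDeriv i θ x • f x) 1 volume
        ≤ eLpNorm (partialDeriv i θ) (6 / 5) volume * eLpNorm (φ n - f) 6 volume := fun n => by
      have := eLpNorm_smul_le_mul_eLpNorm (r := 1) (p := 6 / 5) (q := 6) ((hm n).sub hf6).1 hθd.1
      convert this using 2
      ext x
      simp [mul_sub]
    refine tendsto_of_tendsto_of_tendsto_of_le_of_le tendsto_const_nhds ?_
      (fun _ => zero_le) hle
    simpa using ENNReal.Tendsto.const_mul hφf (Or.inr hθd.2.ne)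
  refine tendsto_nhds_unique (lim1.congr fun n => ?_) lim2.neg
  exact (isWeakPartial_of_contDiff (U := Set.univ) ((hφ n).1.of_le (by simp))).integral_eq hθ

theorem IsMinimizerE.isMinimizingState {Ω : Set E3} (hΩ : IsOpen Ω)
    (hb : Bornology.IsBounded Ω) {κ H : ℝ} {ψ : E3 → ℂ} {A : E3 → E3}
    (h : IsMinimizerE κ H Ω ψ A) : IsMinimizingState Set.univ κ H Ω ψ A := by
  obtain ⟨⟨hψ, hA⟩, hmin⟩ := h
  have : IsFiniteMeasure (volume.restrict Ω) := ⟨by simpa using hb.measure_lt_top⟩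
  have eA : ∀ j x, A x j = (A x - potentialF x) j + potentialF x j := fun j x => by simp
  have hF : MemHomH1Div fun x => potentialF x - potentialF x := by
    simpa only [sub_self] using memHomH1Div_zero
  have hcurl := weakCurl_potentialF isOpen_univ
  refine ⟨Set.subset_univ _, hψ, fun j => ?_, fun i j => ?_, ?_,
    fun φ hφ => hmin φ A hφ hA⟩
  · have h1 : MemLp (fun x => (A x - potentialF x) j) 2 (volume.restrict Ω) :=
      ((hA.1 j).1.restrict Ω).mono_exponent (by norm_num)
    simp only [eA j]
    exact h1.add (memLp_potentialF hΩ hb j)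
  · obtain ⟨g, hg⟩ := MemHomH1.exists_isWeakPartial (hA.1 j) i
    have h1 := hg.add (isWeakPartial_potentialF Set.univ i j)
    simp only [← eA j] at h1
    exact (isWeakPartial_weakPartial ⟨_, h1⟩).mono (Set.subset_univ Ω)
  · rw [← energyWith_zero hΩ κ H hcurl]
    exact hmin _ _ (memW12_zero Ω) hF

theorem isMinimizingState_of_isMinimizer_energyMod {Ω : Set E3} (hΩ : IsOpen Ω) {κ H : ℝ}
    {ψ : E3 → ℂ} {A : E3 → E3} {P : (E3 → E3) → Prop} (hP : ∀ B, P B → MemW12Vec Ω B)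
    {F : E3 → E3} (hF : P F) (hcurl : weakCurl Ω F =ᵐ[volume.restrict Ω] fun _ => beta)
    (h : IsMinimizer (energyMod κ H Ω) Ω P ψ A) : IsMinimizingState Ω κ H Ω ψ A := by
  obtain ⟨⟨hψ, hA⟩, hmin⟩ := h
  refine ⟨Set.Subset.rfl, hψ, fun j => (hP A hA j).1, fun i j => (hP A hA j).isWeakPartial i, ?_,
    fun φ hφ => hmin φ A hφ hA⟩
  rw [← energyWith_zero hΩ κ H hcurl]
  exact hmin _ _ (memW12_zero Ω) hF

theorem exists_isMinimizingState {Ω : Set E3} (hΩ : IsOpen Ω) (hb : Bornology.IsBounded Ω)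
    {κ H : ℝ} {ψ : E3 → ℂ} {A : E3 → E3}
    (h : IsMinimizerE κ H Ω ψ A ∨ IsMinimizerMod κ H Ω ψ A ∨
      (HasGaugedPotential Ω ∧ IsMinimizerModGauge κ H Ω ψ A)) :
    ∃ D, IsMinimizingState D κ H Ω ψ A := by
  rcases h with h | h | ⟨⟨F, hF, hcurl⟩, h⟩
  · exact ⟨_, h.isMinimizingState hΩ hb⟩
  · exact ⟨_, isMinimizingState_of_isMinimizer_energyMod hΩ (fun _ hB => hB)
      (memW12Vec_potentialF hΩ hb) (weakCurl_potentialF hΩ) h⟩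
  · exact ⟨_, isMinimizingState_of_isMinimizer_energyMod hΩ (fun _ hB => hB.1) hF hcurl h⟩

/-! ### Consequences of the localization -/

theorem boundaryLayer_subset {Ω : Set E3} {s : ℝ} (hs : 0 < s) :
    boundaryLayer Ω s ⊆ {x ∈ Ω | Metric.infDist x (frontier Ω) ≤ 1 / √s} := fun x hx => by
  refine ⟨hx.1, ?_⟩
  rw [le_div_iff₀ (Real.sqrt_pos.2 hs), mul_comm]
  exact hx.2

theorem integral_norm_sq_le_of_norm_le_one {α V : Type*} [MeasurableSpace α] {μ : Measure α}
    [NormedAddCommGroup V] {f : α → V} (hf : ∀ᵐ x ∂μ, ‖f x‖ ≤ 1) {M : ℝ} (hM : 0 ≤ M)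
    (hμ : μ Set.univ ≤ ENNReal.ofReal M) : ∫ x, ‖f x‖ ^ 2 ∂μ ≤ M := by
  have : IsFiniteMeasure μ := ⟨hμ.trans_lt ENNReal.ofReal_lt_top⟩
  calc ∫ x, ‖f x‖ ^ 2 ∂μ ≤ ∫ _, (1 : ℝ) ∂μ := by
        refine integral_mono_of_nonneg (Eventually.of_forall fun x => by positivity)
          (integrable_const 1) ?_
        filter_upwards [hf] with x hx
        exact pow_le_one₀ (norm_nonneg _) hx
    _ = (μ Set.univ).toReal := by simp [Measure.real]
    _ ≤ M := ENNReal.toReal_le_of_le_ofReal hM hμ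

theorem eLpNorm_two_le_of_integral_le {V : Type*} [NormedAddCommGroup V] {Ω Λ : Set E3}
    (hΛ : Λ ⊆ Ω) {f : E3 → V} (hf : MemLp f 2 (volume.restrict Ω)) {C : ℝ} (hC : 0 ≤ C)
    (h : ∫ x in Ω, ‖f x‖ ^ 2 ≤ C ^ 2 * ∫ x in Λ, ‖f x‖ ^ 2) :
    eLpNorm f 2 (volume.restrict Ω) ≤ ENNReal.ofReal C * eLpNorm f 2 (volume.restrict Λ) := by
  have e : ∀ {U : Set E3}, MemLp f 2 (volume.restrict U) →
      eLpNorm f 2 (volume.restrict U) ^ 2 = ENNReal.ofReal (∫ x in U, ‖f x‖ ^ 2) := fun hU => by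
    rw [eLpNorm_two_sq]
    exact lintegral_ofReal_of_integrable hU.norm.integrable_sq (fun x => sq_nonneg _)
      fun x => enorm_pow_eq_ofReal _ _
  rw [← ENNReal.pow_le_pow_left_iff two_ne_zero, mul_pow, e hf,
    e (hf.mono_measure (Measure.restrict_mono hΛ le_rfl)), ← ENNReal.ofReal_pow hC,
    ← ENNReal.ofReal_mul (by positivity)]
  exact ENNReal.ofReal_le_ofReal h

/-- Hölder's inequality on a set of small measure; the exponent is 1/2 - 1/p. -/
theorem eLpNorm_two_le_of_volume_le {V : Type*} [NormedAddCommGroup V] {Λ : Set E3} {f : E3 → V}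
    (hf : AEStronglyMeasurable f (volume.restrict Λ)) {p M : ℝ} (hp : 2 ≤ p) (hM : 0 ≤ M)
    (hΛ : volume Λ ≤ ENNReal.ofReal M) :
    eLpNorm f 2 (volume.restrict Λ) ≤ ENNReal.ofReal (M ^ ((p - 2) / (2 * p)))
      * eLpNorm f (ENNReal.ofReal p) (volume.restrict Λ) := by
  have hp0 : 0 < p := by linarith
  have h2p : (2 : ℝ≥0∞) ≤ ENNReal.ofReal p := by
    simpa using ENNReal.ofReal_le_ofReal hp
  have h := eLpNorm_le_eLpNorm_mul_rpow_measure_univ h2p hf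
  have e : 1 / (2 : ℝ≥0∞).toReal - 1 / (ENNReal.ofReal p).toReal = (p - 2) / (2 * p) := by
    rw [ENNReal.toReal_ofReal hp0.le, ENNReal.toReal_ofNat]
    field_simp
  have h0 : 0 ≤ (p - 2) / (2 * p) := div_nonneg (by linarith) (by linarith)
  rw [e, Measure.restrict_apply_univ, mul_comm] at h
  refine h.trans (mul_le_mul_left ?_ _)
  rw [← ENNReal.ofReal_rpow_of_nonneg hM h0]
  exact ENNReal.rpow_le_rpow hΛ h0

end

end GinzburgLandau

/-! ### The theorem: localization, layer volume and Hölder's inequality combined -/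

open GinzburgLandau in
theorem theorem2p5 (Ω : Set E3) (hΩ : IsBoundedLipschitzDomain Ω) :
    ∃ (C C' : ℝ) (Cp : ℝ → ℝ), 0 < C ∧ 0 < C' ∧ (∀ p, 2 ≤ p → 0 < Cp p) ∧
      ∀ (κ H : ℝ) (ψ : E3 → ℂ) (A : E3 → E3),
        (IsMinimizerE κ H Ω ψ A ∨ IsMinimizerMod κ H Ω ψ A ∨
          (HasGaugedPotential Ω ∧ IsMinimizerModGauge κ H Ω ψ A)) →
        1 / 2 ≤ κ * (H - κ) →
        ((∫ x in Ω, ‖ψ x‖ ^ 2) ≤ C * ∫ x in boundaryLayer Ω (κ * (H - κ)), ‖ψ x‖ ^ 2) ∧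
        (C * (∫ x in boundaryLayer Ω (κ * (H - κ)), ‖ψ x‖ ^ 2) ≤ C' / √(κ * (H - κ))) ∧
        ∀ p : ℝ, 2 ≤ p →
          MemLp ψ (ENNReal.ofReal p) (volume.restrict Ω) ∧
          eLpNorm ψ 2 (volume.restrict Ω) ≤
            ENNReal.ofReal (Cp p * (κ * (H - κ)) ^ (-((p - 2) / (4 * p)))) *
              eLpNorm ψ (ENNReal.ofReal p) (volume.restrict Ω) := by
  obtain ⟨V, hV, hvol⟩ := exists_volume_layer_le hΩ
  -- The factor 10 arises because 98 ≤ 10² and norms, not their squares, are compared in the L^p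
  -- statement.
  refine ⟨98, 98 * V, fun p => 10 * V ^ ((p - 2) / (2 * p)), by norm_num, by positivity,
    fun p _ => by positivity, fun κ H ψ A hmin hs => ?_⟩
  obtain ⟨D, hstate⟩ := exists_isMinimizingState hΩ.isOpen hΩ.isBounded hmin
  have hκH : 0 < κ * H := by nlinarith [sq_nonneg κ]
  have hmain := hstate.integral_le_boundaryLayer hΩ.isOpen hΩ.isBounded hs
  have hone := hstate.norm_le_one hΩ.isOpen hΩ.isBounded hκH
  have hψ := hstate.memW12.1
  set s := κ * (H - κ)
  have hs0 : 0 < s := by linarith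
  have hrs : 0 < √s := Real.sqrt_pos.2 hs0
  have hΛΩ : boundaryLayer Ω s ⊆ Ω := fun x hx => hx.1
  have hlayer : volume (boundaryLayer Ω s) ≤ ENNReal.ofReal (V * (1 / √s)) :=
    (measure_mono (boundaryLayer_subset hs0)).trans (hvol _ (by positivity))
  have hres : volume.restrict (boundaryLayer Ω s) ≤ volume.restrict Ω :=
    Measure.restrict_mono hΛΩ le_rfl
  have : IsFiniteMeasure (volume.restrict Ω) := ⟨by simpa using hΩ.isBounded.measure_lt_top⟩
  refine ⟨hmain, ?_, fun p hp => ⟨MemLp.of_bound hψ.1 1 hone, ?_⟩⟩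
  · have h1 := integral_norm_sq_le_of_norm_le_one (ae_mono hres hone)
      (M := V * (1 / √s)) (by positivity) (by simpa using hlayer)
    calc 98 * ∫ x in boundaryLayer Ω s, ‖ψ x‖ ^ 2 ≤ 98 * (V * (1 / √s)) := by gcongr
      _ = 98 * V / √s := by ring
  · have h1 : ∫ x in Ω, ‖ψ x‖ ^ 2 ≤ 10 ^ 2 * ∫ x in boundaryLayer Ω s, ‖ψ x‖ ^ 2 := by
      have : 0 ≤ ∫ x in boundaryLayer Ω s, ‖ψ x‖ ^ 2 := integral_nonneg fun x => by positivity
      linarith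
    have h2 := eLpNorm_two_le_of_integral_le hΛΩ hψ (by norm_num) h1
    have h3 := eLpNorm_two_le_of_volume_le (hψ.1.mono_measure hres) hp
      (by positivity) hlayer
    have h4 : eLpNorm ψ (ENNReal.ofReal p) (volume.restrict (boundaryLayer Ω s))
        ≤ eLpNorm ψ (ENNReal.ofReal p) (volume.restrict Ω) := eLpNorm_mono_measure _ hres
    -- The layer has volume of order s to the power -1/2, which halves the Hölder exponent (p -
    -- 2)/(2p) to the (p - 2)/(4p) of the claim.
    have e : (V * (1 / √s)) ^ ((p - 2) / (2 * p))
        = V ^ ((p - 2) / (2 * p)) * s ^ (-((p - 2) / (4 * p))) := by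
      rw [Real.mul_rpow hV.le (by positivity), Real.sqrt_eq_rpow, one_div, ← Real.rpow_neg hs0.le,
        ← Real.rpow_mul hs0.le]
      congr 2
      have : p ≠ 0 := by linarith
      field_simp
      ring
    calc eLpNorm ψ 2 (volume.restrict Ω)
        ≤ ENNReal.ofReal 10 * (ENNReal.ofReal ((V * (1 / √s)) ^ ((p - 2) / (2 * p)))
          * eLpNorm ψ (ENNReal.ofReal p) (volume.restrict Ω)) := by
          refine h2.trans ?_
          gcongr
          exact h3.trans (by gcongr)
      _ = _ := by
          rw [← mul_assoc, ← ENNReal.ofReal_mul (by norm_num), e, mul_assoc]
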